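/- **Setting.** Let $(\mathsf X,\mathcal X)$ be a measurable space, $M_0$ a probability measure on it, $(M_t)_{t\ge 1}$ Markov transition kernels on $\mathsf X$ and $(g_t)_{t\ge 0}$ nonnegative measurable functions. Assume that there is a reference measure $\nu$ such that $M_0(dx)=m_0(x)\,\nu(dx)$ and $M_t(x,dy)=m_t(x,y)\,\nu(dy)$ for all $t\ge1$, $x\in\mathsf X$, with $m_t$ nonnegative and jointly measurable. For $b\in\{0,1\}^{t+1}$ let $\mu_{b,t}$ be the measure on paths $(x_s,x_s')_{0\le s\le t}$ $$\mu_{b,t}(dx_{0:t},dx'_{0:t})=M_0^{b_0}(dx_0,dx_0')\prod_{s=0}^{t-1}g_s(x_s)g_s(x_s')\prod_{s=1}^{t}M_s^{b_s}(x_{s-1},x_{s-1}';dx_s,dx_s'),$$ where $M_s^{0}(x,x';dz,dz')=M_s(x,dz)M_s(x',dz')$, $M_s^{1}(x,x';dz,dz')=M_s(x,dz)\delta_z(dz')$, and likewise $M_0^0=M_0\otimes M_0$, $M_0^1(dx,dx')=M_0(dx)\delta_x(dx')$. For $h:\mathsf X^2\to\mathbb R$ write $\mu_{b,t}(h)=\int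 h(x_t,x_t')\,d\mu_{b,t}$. **Particle system.** Draw $\xi_0^1,\dots,\xi_0^N$ i.i.d. from $M_0$. Given everything up to time $t-1$, with $\Omega_{t-1}=\sum_{i=1}^N g_{t-1}(\xi_{t-1}^i)$ and $W_{t-1}^j=g_{t-1}(\xi_{t-1}^j)/\Omega_{t-1}$: draw i.i.d. ancestor indices $A_{t-1}^i$ with $\mathbb P(A_{t-1}^i=j)=W_{t-1}^j$, then independently $\xi_t^i\sim M_t(\xi_{t-1}^{A_{t-1}^i},\cdot)$, and then independent indices $J_{k,t-1}^i$, $1\le k\le N$, $1\le i\le M$, with $$\mathbb P(J_{k,t-1}^i=\ell)=\beta_t(k,\ell)=\frac{g_{t-1}(\xi_{t-1}^\ell)\,m_t(\xi_{t-1}^\ell,\xi_t^k)}{\sum_{j=1}^N g_{t-1}(\xi_{t-1}^j)\,m_t(\xi_{t-1}^j,\xi_t^k)} .$$ **Estimator.** Let $\widetilde{\mathcal T}^b_0(k,\ell)=\mathbf 1_{k\ne\ell}$ if $b_0=0$ and $\mathbf 1_{k=\ell}$ if $b_0=1$; for $t\ge1$, $$\widetilde{\mathcal T}^b_t(k,\ell)=\frac{\mathbf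 1_{k\neq\ell}}{M}\sum_{i=1}^M\widetilde{\mathcal T}^b_{t-1}(J^i_{k,t-1},J^i_{\ell,t-1})\ \text{ if } b_t=0,\qquad \widetilde{\mathcal T}^b_t(k,\ell)=\frac{\mathbf 1_{k=\ell}}{M}\sum_{i=1}^M\sum_{j=1}^N W_{t-1}^j\,\widetilde{\mathcal T}^b_{t-1}(J^i_{k,t-1},j)\ \text{ if } b_t=1 .$$ The PaRIS estimator of $\mu_{b,t}(h)$ is $$\mu^{N,M}_{b,t}(h)=\Big\{\prod_{s=0}^tN^{b_s}\Big(\tfrac{N}{N-1}\Big)^{1-b_s}\Big\}\frac{\gamma_t^N(\mathbf 1)^2}{N^2}\sum_{i,j=1}^N\widetilde{\mathcal T}^b_t(i,j)\,h(\xi_t^i,\xi_t^j),\qquad \gamma^N_t(\mathbf 1)=\prod_{s=0}^{t-1}\frac{\Omega_s}{N}.$$ **Theorem.** Assume that * there is $G_\infty>0$ with $0<g_t(x)\le G_\infty$ for all $t\ge0$, $x\in\mathsf X$; * $m_t(x',x)>0$ for all $t\ge1$, $x,x'\in\mathsf X$; * there is $\sigma_+>0$ with $m_t(x',x)\le\sigma_+$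 for all $t\ge1$, $x,x'\in\mathsf X$. Then for every $t\ge0$, $b\in\{0,1\}^{t+1}$, integer $M>1$ and bounded measurable $h:\mathsf X^2\to\mathbb R$, the random variables $\mu^{N,M}_{b,t}(h)$ are square integrable and $$\lim_{N\to\infty}\big\|\mu^{N,M}_{b,t}(h)-\mu_{b,t}(h)\big\|_2=0 .$$ If in addition there is $0<\sigma_-<\sigma_+$ with $m_t(x',x)\ge\sigma_-$ for all $t\ge1$, $x,x'\in\mathsf X$, then $\big\|\mu^{N,M}_{b,t}(h)-\mu_{b,t}(h)\big\|_2=\mathcal O(1/\sqrt N)$ as $N\to\infty$. -/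

import Mathlib

open MeasureTheory ProbabilityTheory Filter Topology

universe u

noncomputable section

namespace PaRIS

/-! ## Two generic Markov kernels -/

section Kernels

variable {α : Type*} [MeasurableSpace α] {ι : Type*} [Fintype ι]

/-- The kernel `a ↦ Categorical(w a)`: index `j` has probability `w a j / ∑ l, w a l`. -/
def categorical [MeasurableSpace ι] (w : α → ι → ℝ) (hw : ∀ j, Measurable fun a => w a j)
    (_hw0 : ∀ a j, 0 ≤ w a j) : Kernel α ι where
  toFun a := ∑ j, ENNReal.ofReal (w a j / ∑ l, w a l) • Measure.dirac j
  measurable' := by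
    refine Measure.measurable_of_measurable_coe _ fun s _ => ?_
    simp only [Measure.coe_finsetSum, Finset.sum_apply, Measure.smul_apply, smul_eq_mul]
    refine Finset.measurable_sum _ fun j _ => Measurable.mul_const ?_ _
    exact ((hw j).div (Finset.measurable_sum _ fun l _ => hw l)).ennreal_ofReal

instance categorical.instIsFiniteKernel [MeasurableSpace ι] (w : α → ι → ℝ) (hw : ∀ j, Measurable fun a => w a j)
    (hw0 : ∀ a j, 0 ≤ w a j) : IsFiniteKernel (categorical w hw hw0) where
  exists_univ_le := by
    refine ⟨1, ENNReal.one_lt_top, fun a => ?_⟩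
    change (∑ j, ENNReal.ofReal (w a j / ∑ l, w a l) • Measure.dirac j : Measure ι) Set.univ ≤ 1
    simp only [Measure.coe_finsetSum, Finset.sum_apply, Measure.smul_apply, smul_eq_mul,
      measure_univ, mul_one]
    rw [← ENNReal.ofReal_sum_of_nonneg
      (fun j _ => div_nonneg (hw0 a j) (Finset.sum_nonneg fun l _ => hw0 a l)),
      ← Finset.sum_div, ← ENNReal.ofReal_one]
    exact ENNReal.ofReal_le_ofReal (div_self_le_one _)

/-- The kernel `a ↦ ⨂ i, κ i a`: given `a`, the coordinates are independent and the `i`-th one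
has law `κ i a`. -/
def piKernel {β : Type*} [MeasurableSpace β] (κ : ι → Kernel α β) [∀ i, IsFiniteKernel (κ i)] :
    Kernel α (ι → β) where
  toFun a := Measure.pi fun i => κ i a
  measurable' := by
    refine Measurable.measure_of_isPiSystem generateFrom_pi.symm isPiSystem_pi ?_ ?_
    · rintro _ ⟨s, hs, rfl⟩
      simp only [Measure.pi_pi]
      exact Finset.measurable_prod _ fun i _ => (κ i).measurable_coe (hs i (Set.mem_univ i))
    · simp only [Measure.pi_univ]
      exact Finset.measurable_prod _ fun i _ => (κ i).measurable_coe MeasurableSet.univ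

instance piKernel.instIsFiniteKernel {β : Type*} [MeasurableSpace β] (κ : ι → Kernel α β) [∀ i, IsFiniteKernel (κ i)] :
    IsFiniteKernel (piKernel κ) where
  exists_univ_le := by
    refine ⟨∏ i, (κ i).bound, ENNReal.prod_lt_top fun i _ => (κ i).bound_lt_top, fun a => ?_⟩
    change (Measure.pi fun i => κ i a) Set.univ ≤ _
    rw [Measure.pi_univ]
    exact Finset.prod_le_prod' fun i _ => Kernel.measure_le_bound _ _ _

end Kernels

/-! ## The Feynman–Kac model -/

/-- A dominated Feynman–Kac (hidden Markov) model on a measurable space: an initial law `init`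
(`M₀`), transition kernels `trans t` from time `t` to time `t + 1` (`M_{t+1}`), nonnegative
potentials `pot t` (`g_t`), and densities `initDens` (`m₀`) and `dens t x` (`m_{t+1}(x, ·)`) of
these laws with respect to a reference measure `ref` (`ν`). -/
structure Model (X : Type u) [MeasurableSpace X] where
  ref : Measure X
  init : Measure X
  trans : ℕ → Kernel X X
  pot : ℕ → X → ℝ
  initDens : X → ℝ
  dens : ℕ → X → X → ℝ
  isProbabilityMeasure_init : IsProbabilityMeasure init
  isMarkovKernel_trans : ∀ t, IsMarkovKernel (trans t)
  measurable_pot : ∀ t, Measurable (pot t)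
  pot_nonneg : ∀ t x, 0 ≤ pot t x
  measurable_initDens : Measurable initDens
  initDens_nonneg : ∀ x, 0 ≤ initDens x
  measurable_dens : ∀ t, Measurable fun p : X × X => dens t p.1 p.2
  dens_nonneg : ∀ t x y, 0 ≤ dens t x y
  init_eq : init = ref.withDensity fun y => ENNReal.ofReal (initDens y)
  trans_eq : ∀ t x, trans t x = ref.withDensity fun y => ENNReal.ofReal (dens t x y)

attribute [instance] Model.isProbabilityMeasure_init Model.isMarkovKernel_trans

variable {X : Type u} [MeasurableSpace X]

namespace Model

variable (F : Model X)

/-! ### The measures `μ_{b,t}` -/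

/-- Initial law of the bivariate chain: two independent draws of `M₀` if the bit is `0`, one
duplicated draw if it is `1`. -/
def biInit (c : Fin 2) : Measure (X × X) :=
  if c = 0 then F.init.prod F.init else F.init.map fun x => (x, x)

/-- Transition of the bivariate chain from time `t` to time `t + 1`: two independent moves
`M_{t+1}(x, dz) M_{t+1}(x', dz')` if the bit is `0`, and `M_{t+1}(x, dz) δ_z(dz')` if it is `1`. -/
def biTrans (t : ℕ) (c : Fin 2) : Kernel (X × X) (X × X) :=
  if c = 0 then Kernel.parallelComp (F.trans t) (F.trans t)
  else ((F.trans t).comap Prod.fst measurable_fst).map fun z => (z, z)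

/-- The measure `μ_{b,t}` on paths `(x_s, x'_s)_{0 ≤ s ≤ t}`: the unnormalized Feynman–Kac path
measure of the bivariate chain, with potentials `g_s(x_s) g_s(x'_s)`, `s < t`. -/
def mu : (t : ℕ) → (Fin (t + 1) → Fin 2) → Measure (Fin (t + 1) → X × X)
  | 0, b => (F.biInit (b 0)).map fun z _ => z
  | t + 1, b =>
    (((mu t fun s => b s.castSucc).withDensity fun p =>
          ENNReal.ofReal (F.pot t (p (Fin.last t)).1 * F.pot t (p (Fin.last t)).2)) ⊗ₘ
        (F.biTrans t (b (Fin.last (t + 1)))).comap (fun p => p (Fin.last t))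
          (measurable_pi_apply _)).map
      fun q => Fin.snoc (α := fun _ => X × X) q.1 q.2

/-- `μ_{b,t}(h)` for a function `h` of the two terminal states `(x_t, x'_t)`. -/
def muTerminal (t : ℕ) (b : Fin (t + 1) → Fin 2) (h : X × X → ℝ) : ℝ :=
  ∫ p, h (p (Fin.last t)) ∂(F.mu t b)

/-! ### The particle filter with backward index sampling -/

variable (N M : ℕ)

/-- Multinomial resampling: given the particles `ξ_t`, the ancestor indices `A_t^i` are i.i.d.
categorical with weights `g_t(ξ_t^j)`. -/
def resample (t : ℕ) : Kernel (Fin N → X) (Fin N → Fin N) :=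
  piKernel fun _ : Fin N =>
    categorical (fun (x : Fin N → X) (j : Fin N) => F.pot t (x j))
      (fun j => (F.measurable_pot t).comp (measurable_pi_apply j)) (fun _ _ => F.pot_nonneg t _)

/-- Mutation: given `ξ_t` and `A_t`, the particles `ξ_{t+1}^i` are independent with law
`M_{t+1}(ξ_t^{A_t^i}, ·)`. -/
def mutate (t : ℕ) : Kernel ((Fin N → X) × (Fin N → Fin N)) (Fin N → X) :=
  piKernel fun i : Fin N =>
    (F.trans t).comap (fun p : (Fin N → X) × (Fin N → Fin N) => p.1 (p.2 i))
      (measurable_from_prod_countable_left fun a => measurable_pi_apply (a i))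

/-- Backward sampling: given `ξ_t`, `A_t` and `ξ_{t+1}`, the indices `J_{k,t}^i` are independent
and `J_{k,t}^i` is categorical with the backward weights
`β(k, ℓ) ∝ g_t(ξ_t^ℓ) m_{t+1}(ξ_t^ℓ, ξ_{t+1}^k)`. -/
def backwardSample (t : ℕ) :
    Kernel ((Fin N → X) × ((Fin N → Fin N) × (Fin N → X))) (Fin N → Fin M → Fin N) :=
  piKernel fun k : Fin N => piKernel fun _ : Fin M =>
    categorical
      (fun (p : (Fin N → X) × ((Fin N → Fin N) × (Fin N → X))) (l : Fin N) =>
        F.pot t (p.1 l) * F.dens t (p.1 l) (p.2.2 k))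
      (fun l => by
        have h1 : Measurable fun p : (Fin N → X) × ((Fin N → Fin N) × (Fin N → X)) => p.1 l :=
          (measurable_pi_apply l).comp measurable_fst
        have h2 : Measurable fun p : (Fin N → X) × ((Fin N → Fin N) × (Fin N → X)) => p.2.2 k :=
          (measurable_pi_apply k).comp (measurable_snd.comp measurable_snd)
        exact ((F.measurable_pot t).comp h1).mul ((F.measurable_dens t).comp (h1.prodMk h2)))
      (fun _ _ => mul_nonneg (F.pot_nonneg t _) (F.dens_nonneg t _ _))

/-- One step of the algorithm: given `ξ_t`, the joint law of `((A_t, ξ_{t+1}), J_t)`. -/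
def step (t : ℕ) :
    Kernel (Fin N → X) (((Fin N → Fin N) × (Fin N → X)) × (Fin N → Fin M → Fin N)) :=
  (F.resample N t ⊗ₖ F.mutate N t) ⊗ₖ F.backwardSample N M t

end Model

/-- All the random variables produced up to time `t`: `ξ_0` at time `0`, and then
`((A_t, ξ_{t+1}), J_t)` when passing from time `t` to time `t + 1`. -/
def History (X : Type u) (N M : ℕ) : ℕ → Type u
  | 0 => Fin N → X
  | t + 1 => History X N M t × (((Fin N → Fin N) × (Fin N → X)) × (Fin N → Fin M → Fin N))

instance History.instMeasurableSpace (N M : ℕ) : (t : ℕ) → MeasurableSpace (History X N M t)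
  | 0 => inferInstanceAs (MeasurableSpace (Fin N → X))
  | t + 1 =>
    @Prod.instMeasurableSpace _ _ (History.instMeasurableSpace N M t)
      (inferInstanceAs
        (MeasurableSpace (((Fin N → Fin N) × (Fin N → X)) × (Fin N → Fin M → Fin N))))

/-- The current particles `ξ_t`. -/
def particles {N M : ℕ} : (t : ℕ) → History X N M t → Fin N → X
  | 0, ω => ω
  | _ + 1, ω => ω.2.1.2

theorem measurable_particles {N M : ℕ} :
    ∀ t, Measurable (particles t : History X N M t → Fin N → X)
  | 0 => measurable_id
  | _ + 1 => measurable_snd.comp (measurable_fst.comp measurable_snd)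

namespace Model

variable (F : Model X) (N M : ℕ)

/-- The joint law of everything produced up to time `t` by the particle filter with `N` particles
and `M` backward indices per particle; the initial particles are i.i.d. with law `M₀`. -/
def law : (t : ℕ) → Measure (History X N M t)
  | 0 => (Measure.pi fun _ : Fin N => F.init : Measure (Fin N → X))
  | t + 1 => law t ⊗ₘ (F.step N M t).comap (particles t) (measurable_particles t)

variable {N M}

/-- The total weight `Ω_t = ∑ i, g_t(ξ_t^i)`. -/
def totalWeight (t : ℕ) (ω : History X N M t) : ℝ := ∑ i, F.pot t (particles t ω i)

/-- The normalized weight `W_t^j = g_t(ξ_t^j) / Ω_t`. -/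
def normWeight (t : ℕ) (ω : History X N M t) (j : Fin N) : ℝ :=
  F.pot t (particles t ω j) / F.totalWeight t ω

/-- The normalizing constant estimate `γ_t^N(1) = ∏_{s < t} Ω_s / N`. -/
def gammaOne : (t : ℕ) → History X N M t → ℝ
  | 0, _ => 1
  | t + 1, ω => gammaOne t ω.1 * (F.totalWeight t ω.1 / N)

/-- The sampled backward statistics `T_t^b(k, l)` of the PaRIS estimator. -/
def stat : (t : ℕ) → (Fin (t + 1) → Fin 2) → History X N M t → Fin N → Fin N → ℝ
  | 0, b, _, k, l => if b 0 = 0 then (if k ≠ l then 1 else 0) else (if k = l then 1 else 0)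
  | t + 1, b, ω, k, l =>
    if b (Fin.last (t + 1)) = 0 then
      (if k ≠ l then 1 else 0) / M *
        ∑ i : Fin M, stat t (fun s => b s.castSucc) ω.1 (ω.2.2 k i) (ω.2.2 l i)
    else
      (if k = l then 1 else 0) / M *
        ∑ i : Fin M, ∑ j : Fin N,
          F.normWeight t ω.1 j * stat t (fun s => b s.castSucc) ω.1 (ω.2.2 k i) j

/-- The PaRIS estimator of `μ_{b,t}(h)`. -/
def parisEstimator (t : ℕ) (b : Fin (t + 1) → Fin 2) (h : X × X → ℝ) (ω : History X N M t) : ℝ :=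
  (∏ s, (N : ℝ) ^ (b s : ℕ) * ((N : ℝ) / (N - 1)) ^ (1 - (b s : ℕ))) *
    (F.gammaOne t ω ^ 2 / (N : ℝ) ^ 2) *
    ∑ i, ∑ j, F.stat t b ω i j * h (particles t ω i, particles t ω j)

/-- The `L²` norm, under the law of the particle system with `N` particles and `M` sampled
indices, of the error of the PaRIS estimator of `μ_{b,t}(h)`. -/
def parisL2Error (t : ℕ) (b : Fin (t + 1) → Fin 2) (h : X × X → ℝ) (M N : ℕ) : ENNReal :=
  eLpNorm (fun ω : History X N M t => F.parisEstimator t b h ω - F.muTerminal t b h) 2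
    (F.law N M t)

end Model

end PaRIS

end

noncomputable section

namespace PaRIS

/-! ## Bounded measurable functions -/

/-! Everything rests on a bias–variance recursion in time, carried out conditionally on the
particles and statistics at time `t`.

Once the ancestors are integrated out, the new particles together with their vectors of `M` backward
indices are i.i.d. (`step_map`). Bayes' formula gives more: a new particle with any single one of
its backward indices has the same law as the particle with its true ancestor (`particleLaw_map`).
Hence, given the past, replacing the statistic by its mean undoes one step of the bivariate chain.
The mean of the estimator of `h` at time `t + 1` is exactly the estimator at time `t` of `biOp h`
(`integral_nextStat`, `stepFactor_mul_mean`). Since `muTerminal` obeys the same recursion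
(`muTerminal_succ`), the conditional bias is the error at time `t`, and only the conditional
variance is to be bounded.

The estimator is a double sum of functions of pairs of independent variables. Covariances of pairs
without a common index vanish, so the variance is at most `4 H ^ 2` times the expected `rowSq`, the
sum of squared row sums of the statistics (`variance_pair_sum_le`, `variance_sum_pairTerm_le`).

The quantity `rowSq` propagates through the recursion. Jensen's inequality over the `M` indices
reduces to one index, hence to i.i.d. ancestors, and the expected squares become weighted sums of
the old statistics. With weights at most `G / Ω`, the factor `(Ω / N) ^ 4` coming from `γ ^ 4`
absorbs all negative powers of `Ω`, so no lower bound on the potentials enters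
(`bitFactor_sq_mul_integral_rowSq_le`). By induction the normalized fourth-order quantity is `O(N ^
3)`; the estimator's prefactor squared brings `N ^ (-4)`, so each time step adds `O(1 / N)` to the
mean squared error. Both limits in the theorem are read off from the resulting bound `C / N`. -/

/-- A bounded measurable real function. -/
structure BddMeas {α : Type*} [MeasurableSpace α] (f : α → ℝ) : Prop where
  meas : Measurable f
  bdd : ∃ C : ℝ, ∀ x, |f x| ≤ C

namespace BddMeas

variable {α β : Type*} [MeasurableSpace α] [MeasurableSpace β] {f g : α → ℝ}

theorem const (c : ℝ) : BddMeas fun _ : α => c := ⟨measurable_const, |c|, fun _ => le_rfl⟩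

theorem add (hf : BddMeas f) (hg : BddMeas g) : BddMeas fun x => f x + g x := by
  obtain ⟨C, hC⟩ := hf.bdd
  obtain ⟨D, hD⟩ := hg.bdd
  exact ⟨hf.meas.add hg.meas, C + D, fun x => (abs_add_le _ _).trans (add_le_add (hC x) (hD x))⟩

theorem mul (hf : BddMeas f) (hg : BddMeas g) : BddMeas fun x => f x * g x := by
  obtain ⟨C, hC⟩ := hf.bdd
  obtain ⟨D, hD⟩ := hg.bdd
  refine ⟨hf.meas.mul hg.meas, C * D, fun x => ?_⟩
  rw [abs_mul]
  exact mul_le_mul (hC x) (hD x) (abs_nonneg _) ((abs_nonneg _).trans (hC x))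

theorem neg (hf : BddMeas f) : BddMeas fun x => - f x := by
  simpa using (const (-1)).mul hf

theorem sub (hf : BddMeas f) (hg : BddMeas g) : BddMeas fun x => f x - g x := by
  simpa [sub_eq_add_neg] using hf.add hg.neg

theorem pow (hf : BddMeas f) (n : ℕ) : BddMeas fun x => f x ^ n := by
  induction n with
  | zero => simpa using const 1
  | succ n ih => simpa [pow_succ] using ih.mul hf

theorem abs (hf : BddMeas f) : BddMeas fun x => |f x| := by
  obtain ⟨C, hC⟩ := hf.bdd
  exact ⟨continuous_abs.measurable.comp hf.meas, C, fun x => by simpa using hC x⟩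

theorem sum {ι : Type*} (s : Finset ι) {f : ι → α → ℝ} (hf : ∀ i ∈ s, BddMeas (f i)) :
    BddMeas fun x => ∑ i ∈ s, f i x := by
  classical
  induction s using Finset.induction_on with
  | empty => simpa using const 0
  | insert a s ha ih =>
    simp only [Finset.sum_insert ha]
    exact (hf a (Finset.mem_insert_self a s)).add
      (ih fun i hi => hf i (Finset.mem_insert_of_mem hi))

theorem comp {f : β → ℝ} (hf : BddMeas f) {g : α → β} (hg : Measurable g) :
    BddMeas fun x => f (g x) :=
  ⟨hf.meas.comp hg, hf.bdd.imp fun _ h x => h (g x)⟩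

theorem integrable (hf : BddMeas f) (μ : Measure α) [IsFiniteMeasure μ] : Integrable f μ := by
  obtain ⟨C, hC⟩ := hf.bdd
  exact Integrable.of_bound hf.meas.aestronglyMeasurable C (ae_of_all _ hC)

theorem memLp (hf : BddMeas f) (p : ENNReal) (μ : Measure α) [IsFiniteMeasure μ] :
    MemLp f p μ := by
  obtain ⟨C, hC⟩ := hf.bdd
  exact MemLp.of_bound hf.meas.aestronglyMeasurable C (ae_of_all _ hC)

theorem of_countable [Finite α] [MeasurableSingletonClass α] (f : α → ℝ) : BddMeas f := by
  obtain ⟨C, hC⟩ := (Set.finite_range fun x => |f x|).bddAbove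
  exact ⟨measurable_of_countable f, C, fun x => hC ⟨x, rfl⟩⟩

theorem integral_kernel {f : α × β → ℝ} (hf : BddMeas f) (κ : Kernel α β) [IsFiniteKernel κ] :
    BddMeas fun a => ∫ y, f (a, y) ∂κ a := by
  obtain ⟨C, hC⟩ := hf.bdd
  -- The bound uses `|C|` because `C` may be negative when `α × β` is empty.
  refine ⟨(hf.meas.stronglyMeasurable.integral_kernel_prod_right' (κ := κ)).measurable,
    |C| * κ.bound.toReal, fun a => ?_⟩
  have := norm_integral_le_of_norm_le_const (μ := κ a) (f := fun y => f (a, y))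
    (ae_of_all _ fun y => (hC (a, y)).trans (le_abs_self C))
  exact this.trans (mul_le_mul_of_nonneg_left
    (ENNReal.toReal_mono κ.bound_ne_top (κ.measure_le_bound a _)) (abs_nonneg C))

end BddMeas

/-! ## Product measures -/

section Pi

variable {ι α : Type*} [Fintype ι] [MeasurableSpace α]

theorem lintegral_pi_prod {μ : ι → Measure α} [∀ i, IsProbabilityMeasure (μ i)]
    {f : ι → α → ENNReal} (hf : ∀ i, Measurable (f i)) :
    ∫⁻ x, ∏ i, f i (x i) ∂(Measure.pi μ) = ∏ i, ∫⁻ a, f i a ∂(μ i) := by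
  have h := iIndepFun_pi (μ := μ) (X := f) fun i => (hf i).aemeasurable
  have h2 := lintegral_prod_eq_prod_lintegral_of_indepFun Finset.univ _ h
    fun i => (hf i).comp (measurable_pi_apply i)
  refine Eq.trans ?_ (h2.trans ?_)
  · rfl
  · refine Finset.prod_congr rfl fun i _ => ?_
    rw [← (measurePreserving_eval μ i).lintegral_comp (hf i)]

variable (ρ : Measure α) [IsProbabilityMeasure ρ]

theorem iIndepFun_eval : iIndepFun (fun (i : ι) (z : ι → α) => z i) (Measure.pi fun _ => ρ) :=
  iIndepFun_pi (X := fun _ a => a) fun _ => aemeasurable_id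

theorem pi_map_pair {k l : ι} (hkl : k ≠ l) :
    (Measure.pi fun _ : ι => ρ).map (fun z => (z k, z l)) = ρ.prod ρ := by
  have h := ((iIndepFun_eval (ι := ι) ρ).indepFun hkl).map_prod_eq_prod_map_map
    (measurable_pi_apply k).aemeasurable (measurable_pi_apply l).aemeasurable
  rw [h]
  congr 1
  · exact (measurePreserving_eval (fun _ : ι => ρ) k).map_eq
  · exact (measurePreserving_eval (fun _ : ι => ρ) l).map_eq

theorem pi_map_triple {k l l' : ι} (hkl : k ≠ l) (hkl' : k ≠ l') (hl : l ≠ l') :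
    (Measure.pi fun _ : ι => ρ).map (fun z => ((z k, z l), z l')) = (ρ.prod ρ).prod ρ := by
  have h := ((iIndepFun_eval (ι := ι) ρ).indepFun_prodMk (fun i => measurable_pi_apply i)
    k l l' hkl' hl).map_prod_eq_prod_map_map
    ((measurable_pi_apply k).prodMk (measurable_pi_apply l)).aemeasurable
    (measurable_pi_apply l').aemeasurable
  rw [h, pi_map_pair ρ hkl]
  congr 1
  exact (measurePreserving_eval (fun _ : ι => ρ) l').map_eq

/-- Variance bound for a double sum of functions of pairs of independent variables: only the
pairs of index pairs that share an index contribute. -/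
theorem variance_pair_sum_le [DecidableEq ι] (f : ι → ι → α × α → ℝ)
    (hf : ∀ k l, BddMeas (f k l)) {e : ι → ι → ℝ} (he : ∀ k l, 0 ≤ e k l) {θ : ℝ}
    (hmean : ∀ k l, ∫ z, f k l (z k, z l) ∂(Measure.pi fun _ : ι => ρ) = e k l * θ) :
    Var[fun z => ∑ p : ι × ι, f p.1 p.2 (z p.1, z p.2); Measure.pi fun _ : ι => ρ] ≤
      ∫ z, ∑ j, (∑ l, |f j l (z j, z l)| + ∑ l, |f l j (z l, z j)|) ^ 2
        ∂(Measure.pi fun _ : ι => ρ) := by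
  set P := Measure.pi fun _ : ι => ρ
  set Y : ι × ι → (ι → α) → ℝ := fun p z => f p.1 p.2 (z p.1, z p.2) with hY
  have hYb : ∀ p, BddMeas (Y p) := fun p => (hf p.1 p.2).comp (by fun_prop)
  -- `o j p` counts the occurrences of `j` in the pair `p`. If `p` and `q` share an index `j`, then
  -- `o j p * o j q ≥ 1`, so summing these products over `j` dominates the indicator of overlapping
  -- pairs and turns the double sum over `p`, `q` into a sum of squares.
  let o : ι → ι × ι → ℝ := fun j p => (if p.1 = j then 1 else 0) + (if p.2 = j then 1 else 0)
  have ho : ∀ j p, 0 ≤ o j p := fun j p => by dsimp only [o]; positivity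
  have hkey : ∀ p q, cov[Y p, Y q; P] ≤ ∫ z, ∑ j, (o j p * |Y p z|) * (o j q * |Y q z|) ∂P := by
    intro p q
    have hnn : ∀ z, 0 ≤ ∑ j, (o j p * |Y p z|) * (o j q * |Y q z|) := fun z =>
      Finset.sum_nonneg fun j _ => mul_nonneg (mul_nonneg (ho _ _) (abs_nonneg _))
        (mul_nonneg (ho _ _) (abs_nonneg _))
    by_cases hd : p.1 ≠ q.1 ∧ p.1 ≠ q.2 ∧ p.2 ≠ q.1 ∧ p.2 ≠ q.2
    · have hi := (iIndepFun_eval (ι := ι) ρ).indepFun_prodMk_prodMk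
        (fun i => measurable_pi_apply i) p.1 p.2 q.1 q.2 hd.1 hd.2.1 hd.2.2.1 hd.2.2.2
      have hi2 : IndepFun (Y p) (Y q) P := hi.comp (hf p.1 p.2).meas (hf q.1 q.2).meas
      rw [hi2.covariance_eq_zero ((hYb p).memLp 2 P) ((hYb q).memLp 2 P)]
      exact integral_nonneg hnn
    · have hj : ∃ j, 1 ≤ o j p * o j q := by
        have : ∃ j, (p.1 = j ∨ p.2 = j) ∧ (q.1 = j ∨ q.2 = j) := by
          by_contra hc
          push Not at hc
          refine hd ⟨fun h => ?_, fun h => ?_, fun h => ?_, fun h => ?_⟩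
          · exact (hc p.1 (Or.inl rfl)).1 h.symm
          · exact (hc p.1 (Or.inl rfl)).2 h.symm
          · exact (hc p.2 (Or.inr rfl)).1 h.symm
          · exact (hc p.2 (Or.inr rfl)).2 h.symm
        obtain ⟨j, hp, hq⟩ := this
        have h1 : ∀ p : ι × ι, (p.1 = j ∨ p.2 = j) → 1 ≤ o j p := by
          rintro p (h | h)
          · dsimp only [o]; rw [if_pos h]; split_ifs <;> norm_num
          · dsimp only [o]; rw [if_pos h]; split_ifs <;> norm_num
        exact ⟨j, one_le_mul_of_one_le_of_one_le (h1 p hp) (h1 q hq)⟩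
      obtain ⟨j, hj⟩ := hj
      rw [covariance_eq_sub ((hYb p).memLp 2 P) ((hYb q).memLp 2 P)]
      -- All means are nonnegative multiples of the same `θ`, so their products are nonnegative
      -- whatever its sign, and the covariance is at most the mixed second moment.
      have hpq : 0 ≤ P[Y p] * P[Y q] := by
        have h1 : P[Y p] = e p.1 p.2 * θ := hmean p.1 p.2
        have h2 : P[Y q] = e q.1 q.2 * θ := hmean q.1 q.2
        rw [h1, h2]
        nlinarith [mul_nonneg (mul_nonneg (he p.1 p.2) (he q.1 q.2)) (sq_nonneg θ)]
      refine (sub_le_self _ hpq).trans ?_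
      refine integral_mono (((hYb p).mul (hYb q)).integrable P) ?_ fun z => ?_
      · exact (BddMeas.sum _ fun j _ => ((BddMeas.const _).mul (hYb p).abs).mul
          ((BddMeas.const _).mul (hYb q).abs)).integrable P
      · calc (Y p * Y q) z ≤ |Y p z| * |Y q z| := by
              rw [Pi.mul_apply, ← abs_mul]; exact le_abs_self _
          _ ≤ (o j p * o j q) * (|Y p z| * |Y q z|) :=
              le_mul_of_one_le_left (by positivity) hj
          _ = (o j p * |Y p z|) * (o j q * |Y q z|) := by ring
          _ ≤ _ := Finset.single_le_sum (f := fun j => (o j p * |Y p z|) * (o j q * |Y q z|))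
              (fun j _ => mul_nonneg (mul_nonneg (ho _ _) (abs_nonneg _))
                (mul_nonneg (ho _ _) (abs_nonneg _))) (Finset.mem_univ j)
  rw [variance_fun_sum fun p => (hYb p).memLp 2 P]
  refine (Finset.sum_le_sum fun p _ => Finset.sum_le_sum fun q _ => hkey p q).trans (le_of_eq ?_)
  have hint : ∀ p q, Integrable (fun z => ∑ j, (o j p * |Y p z|) * (o j q * |Y q z|)) P :=
    fun p q => (BddMeas.sum _ fun j _ => ((BddMeas.const _).mul (hYb p).abs).mul
          ((BddMeas.const _).mul (hYb q).abs)).integrable P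
  calc _ = ∑ p, ∫ z, ∑ q, ∑ j, (o j p * |Y p z|) * (o j q * |Y q z|) ∂P :=
        Finset.sum_congr rfl fun p _ => (integral_finsetSum _ fun q _ => hint p q).symm
    _ = ∫ z, ∑ p, ∑ q, ∑ j, (o j p * |Y p z|) * (o j q * |Y q z|) ∂P :=
        (integral_finsetSum _ fun p _ => integrable_finsetSum _ fun q _ => hint p q).symm
    _ = _ := by
      congr 1
      ext z
      have : ∀ j, ∑ l, |f j l (z j, z l)| + ∑ l, |f l j (z l, z j)| = ∑ p, o j p * |Y p z| := by
        intro j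
        simp only [o, add_mul, Finset.sum_add_distrib, hY, Fintype.sum_prod_type, ite_mul,
          one_mul, zero_mul]
        congr 1
        · rw [Finset.sum_comm]
          simp
        · simp
      simp only [this, pow_two, Finset.sum_mul_sum]
      rw [Finset.sum_comm (s := Finset.univ (α := ι))]
      exact Finset.sum_congr rfl fun p _ => Finset.sum_comm

end Pi

end PaRIS

namespace PaRIS

/-! ## Categorical and product kernels -/

section Kernels

variable {α : Type*} [MeasurableSpace α] {ι : Type*} [Fintype ι]

theorem categorical_apply [MeasurableSpace ι] (w : α → ι → ℝ)
    (hw : ∀ j, Measurable fun a => w a j) (hw0 : ∀ a j, 0 ≤ w a j) (a : α) :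
    categorical w hw hw0 a = ∑ j, ENNReal.ofReal (w a j / ∑ l, w a l) • Measure.dirac j := rfl

theorem sum_ofReal_div_sum {w : ι → ℝ} (hw0 : ∀ j, 0 ≤ w j) (hpos : 0 < ∑ j, w j) :
    ∑ j, ENNReal.ofReal (w j / ∑ l, w l) = 1 := by
  rw [← ENNReal.ofReal_sum_of_nonneg
    (fun j _ => div_nonneg (hw0 j) (Finset.sum_nonneg fun l _ => hw0 l)),
    ← Finset.sum_div, div_self hpos.ne', ENNReal.ofReal_one]

theorem isMarkovKernel_categorical [MeasurableSpace ι] (w : α → ι → ℝ)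
    (hw : ∀ j, Measurable fun a => w a j) (hw0 : ∀ a j, 0 ≤ w a j)
    (hpos : ∀ a, 0 < ∑ j, w a j) : IsMarkovKernel (categorical w hw hw0) where
  isProbabilityMeasure a := ⟨by
    rw [categorical_apply]
    simp only [Measure.coe_finsetSum, Finset.sum_apply, Measure.smul_apply, smul_eq_mul,
      measure_univ, mul_one]
    exact sum_ofReal_div_sum (hw0 a) (hpos a)⟩

theorem lintegral_categorical [MeasurableSpace ι] [MeasurableSingletonClass ι] (w : α → ι → ℝ)
    (hw : ∀ j, Measurable fun a => w a j) (hw0 : ∀ a j, 0 ≤ w a j) (a : α) (f : ι → ENNReal) :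
    ∫⁻ j, f j ∂(categorical w hw hw0 a) = ∑ j, ENNReal.ofReal (w a j / ∑ l, w a l) * f j := by
  rw [categorical_apply, lintegral_finsetSum_measure]
  simp [lintegral_smul_measure]

theorem piKernel_apply {β : Type*} [MeasurableSpace β] (κ : ι → Kernel α β)
    [∀ i, IsFiniteKernel (κ i)] (a : α) : piKernel κ a = Measure.pi fun i => κ i a := rfl

theorem isMarkovKernel_piKernel {β : Type*} [MeasurableSpace β] (κ : ι → Kernel α β)
    [∀ i, IsMarkovKernel (κ i)] : IsMarkovKernel (piKernel κ) where
  isProbabilityMeasure a := by rw [piKernel_apply]; infer_instance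

end Kernels

variable {X : Type u} [MeasurableSpace X]

/-! ### Conditional law of one step of the particle system -/

namespace Model

variable (F : Model X) {N M : ℕ}

instance isMarkovKernel_mutate (t : ℕ) : IsMarkovKernel (F.mutate N t) := by
  unfold mutate
  exact isMarkovKernel_piKernel _

instance isFiniteKernel_resample (t : ℕ) : IsFiniteKernel (F.resample N t) := by
  unfold resample; infer_instance

instance isFiniteKernel_backwardSample (t : ℕ) : IsFiniteKernel (F.backwardSample N M t) := by
  unfold backwardSample; infer_instance

instance isFiniteKernel_step (t : ℕ) : IsFiniteKernel (F.step N M t) := by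
  unfold step; infer_instance

-- Finite rather than probability: `categorical` has mass zero where all weights vanish, so this
-- form needs neither positive potentials nor positive `N`.
instance isFiniteMeasure_law (t : ℕ) : IsFiniteMeasure (F.law N M t) := by
  induction t with
  | zero =>
    exact inferInstanceAs (IsFiniteMeasure (Measure.pi fun _ : Fin N => F.init))
  | succ t ih =>
    exact inferInstanceAs (IsFiniteMeasure
      (F.law N M t ⊗ₘ (F.step N M t).comap (particles t) (measurable_particles t)))

/-- The backward kernel: given the particles `x` at time `t` and the position `y` of a particle at
time `t + 1`, draw `M` independent backward indices. -/
def backKernel (M t : ℕ) (x : Fin N → X) : Kernel X (Fin M → Fin N) :=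
  piKernel fun _ : Fin M => categorical (fun y l => F.pot t (x l) * F.dens t (x l) y)
    (fun l => ((F.measurable_dens t).comp
      (by fun_prop : Measurable fun y : X => (x l, y))).const_mul _)
    (fun _ _ => mul_nonneg (F.pot_nonneg t _) (F.dens_nonneg t _ _))

instance isFiniteKernel_backKernel (t : ℕ) (x : Fin N → X) :
    IsFiniteKernel (F.backKernel M t x) := by
  unfold backKernel; infer_instance

/-- The normalized weight of the `m`-th particle of the configuration `x`. -/
def weight (t : ℕ) (x : Fin N → X) (m : Fin N) : ℝ := F.pot t (x m) / ∑ l, F.pot t (x l)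

theorem weight_nonneg (t : ℕ) (x : Fin N → X) (m : Fin N) : 0 ≤ F.weight t x m :=
  div_nonneg (F.pot_nonneg _ _) (Finset.sum_nonneg fun _ _ => F.pot_nonneg _ _)

/-- The predictive law of one particle, as a mixture of transitions. -/
def mixture (t : ℕ) (x : Fin N → X) : Measure X :=
  ∑ m, ENNReal.ofReal (F.weight t x m) • F.trans t (x m)

/-- The law of one particle at time `t + 1` together with its `M` backward indices, given the
particles `x` at time `t`. -/
def particleLaw (M t : ℕ) (x : Fin N → X) : Measure (X × (Fin M → Fin N)) :=
  F.mixture t x ⊗ₘ F.backKernel M t x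

/-- The law of one particle at time `t + 1` together with the index of its ancestor. -/
def ancestorLaw (t : ℕ) (x : Fin N → X) : Measure (X × Fin N) :=
  ∑ m, ENNReal.ofReal (F.weight t x m) • (F.trans t (x m)).map fun y => (y, m)

instance isFiniteMeasure_mixture (t : ℕ) (x : Fin N → X) : IsFiniteMeasure (F.mixture t x) := by
  refine ⟨?_⟩
  simp [mixture]

instance isFiniteMeasure_particleLaw (t : ℕ) (x : Fin N → X) :
    IsFiniteMeasure (F.particleLaw M t x) := by
  unfold particleLaw; infer_instance

/-- Given the ancestors, the pairs (particle, backward indices) are independent, and the backward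
law involves only the old configuration and the new position. Averaging over the i.i.d. ancestors
then factorizes over `k`, each factor being an integral against the mixture. It suffices to check
this on rectangles. -/
theorem step_map (hpot : ∀ (t : ℕ) (x : X), 0 < F.pot t x) (hN : 0 < N) (t : ℕ) (x : Fin N → X) :
    (F.step N M t x).map (fun p k => (p.1.2 k, p.2 k)) =
      Measure.pi fun _ : Fin N => F.particleLaw M t x := by
  have : Nonempty (Fin N) := ⟨⟨0, hN⟩⟩
  symm
  refine Measure.pi_eq fun s hs => ?_
  have hmeas : Measurable fun (p : ((Fin N → Fin N) × (Fin N → X)) × (Fin N → Fin M → Fin N))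
      (k : Fin N) => (p.1.2 k, p.2 k) := by
    refine measurable_pi_lambda _ fun k => ?_
    exact ((measurable_pi_apply k).comp (measurable_snd.comp measurable_fst)).prodMk
      ((measurable_pi_apply k).comp measurable_snd)
  rw [Measure.map_apply hmeas (MeasurableSet.univ_pi hs), step,
    Kernel.compProd_apply (hmeas (MeasurableSet.univ_pi hs))]
  have hg : ∀ k, Measurable fun y => F.backKernel M t x y (Prod.mk y ⁻¹' s k) := fun k =>
    Kernel.measurable_kernel_prodMk_left (hs k)
  have h1 : ∀ p : (Fin N → Fin N) × (Fin N → X), F.backwardSample N M t (x, p)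
      (Prod.mk p ⁻¹' ((fun (p : ((Fin N → Fin N) × (Fin N → X)) × (Fin N → Fin M → Fin N))
        (k : Fin N) => (p.1.2 k, p.2 k)) ⁻¹' Set.univ.pi s)) =
      ∏ k, F.backKernel M t x (p.2 k) (Prod.mk (p.2 k) ⁻¹' s k) := by
    intro p
    have : (Prod.mk p ⁻¹' ((fun (p : ((Fin N → Fin N) × (Fin N → X)) × (Fin N → Fin M → Fin N))
        (k : Fin N) => (p.1.2 k, p.2 k)) ⁻¹' Set.univ.pi s)) =
        Set.univ.pi fun k => Prod.mk (p.2 k) ⁻¹' s k := by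
      ext J
      simp [Set.mem_pi]
    rw [this]
    exact Measure.pi_pi _ _
  simp only [h1]
  have hprod : Measurable fun p : (Fin N → Fin N) × (Fin N → X) =>
      ∏ k, F.backKernel M t x (p.2 k) (Prod.mk (p.2 k) ⁻¹' s k) :=
    Finset.measurable_prod _ fun k _ => (hg k).comp ((measurable_pi_apply k).comp measurable_snd)
  rw [Kernel.lintegral_compProd _ _ _ hprod]
  have h2 : ∀ A : Fin N → Fin N,
      ∫⁻ ξ, ∏ k, F.backKernel M t x (ξ k) (Prod.mk (ξ k) ⁻¹' s k) ∂(F.mutate N t (x, A)) =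
        ∏ k, ∫⁻ y, F.backKernel M t x y (Prod.mk y ⁻¹' s k) ∂(F.trans t (x (A k))) :=
    fun A => lintegral_pi_prod (μ := fun k => F.trans t (x (A k))) hg
  simp only [h2]
  have : IsMarkovKernel (categorical (fun (x : Fin N → X) (j : Fin N) => F.pot t (x j))
      (fun j => (F.measurable_pot t).comp (measurable_pi_apply j))
      (fun _ _ => F.pot_nonneg t _)) :=
    isMarkovKernel_categorical _ _ _ fun x =>
      Finset.sum_pos (fun _ _ => hpot t _) Finset.univ_nonempty
  refine (lintegral_pi_prod (μ := fun _ : Fin N => categorical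
    (fun (x : Fin N → X) (j : Fin N) => F.pot t (x j))
      (fun j => (F.measurable_pot t).comp (measurable_pi_apply j))
      (fun _ _ => F.pot_nonneg t _) x)
    (f := fun k j => ∫⁻ y, F.backKernel M t x y (Prod.mk y ⁻¹' s k) ∂(F.trans t (x j)))
    fun _ => measurable_of_countable _).trans ?_
  refine Finset.prod_congr rfl fun k _ => ?_
  rw [lintegral_categorical, particleLaw, Measure.compProd_apply (hs k), mixture,
    lintegral_finsetSum_measure]
  simp [lintegral_smul_measure, weight]

/-- Bayes' formula: the density of the mixture at `y` is `∑ l, W l * m (x l, y)`, which cancels the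
denominator of the backward probability and leaves `W l * m (x l, y)`, the joint density of position
and ancestor. Positivity of the densities makes the denominator nonzero at every `y`. -/
theorem particleLaw_map (hdens : ∀ (t : ℕ) (x x' : X), 0 < F.dens t x' x)
    (hpot : ∀ (t : ℕ) (x : X), 0 < F.pot t x) (hN : 0 < N) (t : ℕ) (x : Fin N → X) (i : Fin M) :
    (F.particleLaw M t x).map (fun z => (z.1, z.2 i)) = F.ancestorLaw t x := by
  have : Nonempty (Fin N) := ⟨⟨0, hN⟩⟩
  refine Measure.ext_of_lintegral _ fun f hf => ?_
  have hm : Measurable fun z : X × (Fin M → Fin N) => (z.1, z.2 i) := by fun_prop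
  have hd : ∀ l, Measurable fun y => F.dens t (x l) y := fun l =>
    (F.measurable_dens t).comp (by fun_prop : Measurable fun y : X => (x l, y))
  have hpos : ∀ y, 0 < ∑ l, F.pot t (x l) * F.dens t (x l) y := fun y =>
    Finset.sum_pos (fun _ _ => mul_pos (hpot t _) (hdens t _ _)) Finset.univ_nonempty
  have hΩ : 0 < ∑ l, F.pot t (x l) :=
    Finset.sum_pos (fun _ _ => hpot t _) Finset.univ_nonempty
  have hfl : ∀ l : Fin N, Measurable fun y => f (y, l) := fun l => hf.comp (by fun_prop)
  set β : Fin N → X → ENNReal := fun l y => ENNReal.ofReal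
    (F.pot t (x l) * F.dens t (x l) y / ∑ j, F.pot t (x j) * F.dens t (x j) y) with hβ
  have hβm : ∀ l, Measurable (β l) := fun l => (((hd l).const_mul _).div
    (Finset.measurable_sum _ fun j _ => (hd j).const_mul _)).ennreal_ofReal
  set S : X → ENNReal := fun y => ∑ l, β l y * f (y, l) with hS
  have hSm : Measurable S := Finset.measurable_sum _ fun l _ => (hβm l).mul (hfl l)
  have hback : ∀ y, ∫⁻ J, f (y, J i) ∂(F.backKernel M t x y) = S y := by
    intro y
    have : IsMarkovKernel (categorical (fun y l => F.pot t (x l) * F.dens t (x l) y)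
        (fun l => (hd l).const_mul _)
        (fun _ _ => mul_nonneg (F.pot_nonneg t _) (F.dens_nonneg t _ _))) :=
      isMarkovKernel_categorical _ _ _ hpos
    have := (measurePreserving_eval (fun _ : Fin M =>
      (categorical (fun y l => F.pot t (x l) * F.dens t (x l) y)
        (fun l => (hd l).const_mul _)
        (fun _ _ => mul_nonneg (F.pot_nonneg t _) (F.dens_nonneg t _ _))) y) i).lintegral_comp
        (f := fun l => f (y, l)) (measurable_of_countable _)
    refine Eq.trans this ?_
    rw [lintegral_categorical]
  have hfm : Measurable fun z : X × (Fin M → Fin N) => f (z.1, z.2 i) := hf.comp hm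
  rw [lintegral_map hf hm, particleLaw, Measure.lintegral_compProd hfm]
  simp only [hback]
  rw [mixture, ancestorLaw, lintegral_finsetSum_measure, lintegral_finsetSum_measure]
  simp only [lintegral_smul_measure, smul_eq_mul]
  have hdm : ∀ l, Measurable fun y => ENNReal.ofReal (F.dens t (x l) y) := fun l =>
    (hd l).ennreal_ofReal
  have hmap : ∀ m : Fin N, ∫⁻ z, f z ∂((F.trans t (x m)).map fun y => (y, m)) =
      ∫⁻ y, ENNReal.ofReal (F.dens t (x m) y) * f (y, m) ∂F.ref := by
    intro m
    rw [lintegral_map hf (by fun_prop), F.trans_eq,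
      lintegral_withDensity_eq_lintegral_mul _ (hdm m) (hfl m)]
    rfl
  have hSi : ∀ m : Fin N, ∫⁻ y, S y ∂(F.trans t (x m)) =
      ∫⁻ y, ENNReal.ofReal (F.dens t (x m) y) * S y ∂F.ref := by
    intro m
    rw [F.trans_eq, lintegral_withDensity_eq_lintegral_mul _ (hdm m) hSm]
    rfl
  simp only [hmap, hSi]
  simp_rw [← lintegral_const_mul' _ _ ENNReal.ofReal_ne_top]
  have hA : ∀ m, Measurable fun y =>
      ENNReal.ofReal (F.weight t x m) * (ENNReal.ofReal (F.dens t (x m) y) * S y) :=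
    fun m => ((hdm m).mul hSm).const_mul _
  have hB : ∀ m, Measurable fun y =>
      ENNReal.ofReal (F.weight t x m) * (ENNReal.ofReal (F.dens t (x m) y) * f (y, m)) :=
    fun m => ((hdm m).mul (hfl m)).const_mul _
  rw [← lintegral_finsetSum _ fun m _ => hA m, ← lintegral_finsetSum _ fun m _ => hB m]
  congr 1
  ext y
  simp_rw [← mul_assoc]
  rw [← Finset.sum_mul, hS, Finset.mul_sum]
  refine Finset.sum_congr rfl fun l _ => ?_
  rw [← mul_assoc]
  congr 1
  have hw : ∀ m, ENNReal.ofReal (F.weight t x m) * ENNReal.ofReal (F.dens t (x m) y) =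
      ENNReal.ofReal (F.pot t (x m) * F.dens t (x m) y / ∑ l, F.pot t (x l)) := by
    intro m
    rw [← ENNReal.ofReal_mul (F.weight_nonneg t x m), weight, div_mul_eq_mul_div]
  simp only [hw]
  rw [← ENNReal.ofReal_sum_of_nonneg (fun m _ => div_nonneg
    (mul_nonneg (F.pot_nonneg _ _) (F.dens_nonneg _ _ _)) hΩ.le), ← Finset.sum_div, hβ,
    ← ENNReal.ofReal_mul (div_nonneg (hpos y).le hΩ.le)]
  congr 1
  have := (hpos y).ne'
  field_simp


theorem sum_weight (hpot : ∀ (t : ℕ) (x : X), 0 < F.pot t x) (hN : 0 < N) (t : ℕ)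
    (x : Fin N → X) : ∑ m, F.weight t x m = 1 := by
  have : Nonempty (Fin N) := ⟨⟨0, hN⟩⟩
  have hΩ : 0 < ∑ l, F.pot t (x l) :=
    Finset.sum_pos (fun _ _ => hpot t _) Finset.univ_nonempty
  simp only [weight]
  rw [← Finset.sum_div, div_self hΩ.ne']

theorem isProbabilityMeasure_particleLaw (hdens : ∀ (t : ℕ) (x x' : X), 0 < F.dens t x' x)
    (hpot : ∀ (t : ℕ) (x : X), 0 < F.pot t x) (hN : 0 < N) (t : ℕ) (x : Fin N → X) :
    IsProbabilityMeasure (F.particleLaw M t x) := by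
  have : Nonempty (Fin N) := ⟨⟨0, hN⟩⟩
  have : IsProbabilityMeasure (F.mixture t x) := ⟨by
    simp only [mixture, Measure.coe_finsetSum, Finset.sum_apply, Measure.smul_apply, smul_eq_mul,
      measure_univ, mul_one]
    rw [← ENNReal.ofReal_sum_of_nonneg fun m _ => F.weight_nonneg t x m,
      F.sum_weight hpot hN, ENNReal.ofReal_one]⟩
  have hc : IsMarkovKernel (F.backKernel M t x) := by
    have := isMarkovKernel_categorical (fun y l => F.pot t (x l) * F.dens t (x l) y)
      (fun l => ((F.measurable_dens t).comp
        (by fun_prop : Measurable fun y : X => (x l, y))).const_mul _)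
      (fun _ _ => mul_nonneg (F.pot_nonneg t _) (F.dens_nonneg t _ _))
      fun y => Finset.sum_pos (fun _ _ => mul_pos (hpot t _) (hdens t _ _)) Finset.univ_nonempty
    exact isMarkovKernel_piKernel _
  unfold particleLaw
  infer_instance

theorem isProbabilityMeasure_ancestorLaw (hpot : ∀ (t : ℕ) (x : X), 0 < F.pot t x) (hN : 0 < N)
    (t : ℕ) (x : Fin N → X) : IsProbabilityMeasure (F.ancestorLaw t x) := ⟨by
  simp only [ancestorLaw, Measure.coe_finsetSum, Finset.sum_apply, Measure.smul_apply,
    smul_eq_mul]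
  have : ∀ m : Fin N, (F.trans t (x m)).map (fun y => (y, m)) Set.univ = 1 := fun m => by
    rw [Measure.map_apply (by fun_prop) MeasurableSet.univ]; simp
  simp only [this, mul_one]
  rw [← ENNReal.ofReal_sum_of_nonneg fun m _ => F.weight_nonneg t x m,
    F.sum_weight hpot hN, ENNReal.ofReal_one]⟩

theorem integral_ancestorLaw (t : ℕ) (x : Fin N → X) {f : X × Fin N → ℝ} (hf : BddMeas f) :
    ∫ z, f z ∂(F.ancestorLaw t x) = ∑ m, F.weight t x m * ∫ y, f (y, m) ∂(F.trans t (x m)) := by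
  have hm : ∀ m : Fin N, Measurable fun y : X => (y, m) := fun m => by fun_prop
  rw [ancestorLaw, integral_finsetSum_measure fun m _ =>
    ((hf.integrable ((F.trans t (x m)).map fun y => (y, m))).smul_measure ENNReal.ofReal_ne_top)]
  refine Finset.sum_congr rfl fun m _ => ?_
  rw [integral_smul_measure, integral_map (hm m).aemeasurable hf.meas.aestronglyMeasurable,
    ENNReal.toReal_ofReal (F.weight_nonneg t x m), smul_eq_mul]

/-- Under the law of the particles and of their backward indices, the particles together with
their `i`-th backward indices are independent with the law of a particle and its ancestor. -/
theorem pi_particleLaw_map (hdens : ∀ (t : ℕ) (x x' : X), 0 < F.dens t x' x)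
    (hpot : ∀ (t : ℕ) (x : X), 0 < F.pot t x) (hN : 0 < N) (t : ℕ) (x : Fin N → X) (i : Fin M) :
    (Measure.pi fun _ : Fin N => F.particleLaw M t x).map (fun z k => ((z k).1, (z k).2 i)) =
      Measure.pi fun _ : Fin N => F.ancestorLaw t x := by
  have := F.isProbabilityMeasure_particleLaw (M := M) hdens hpot hN t x
  have hm : Measurable fun z : X × (Fin M → Fin N) => (z.1, z.2 i) := by fun_prop
  have := Measure.pi_map_pi (μ := fun _ : Fin N => F.particleLaw M t x)
    (f := fun _ (z : X × (Fin M → Fin N)) => (z.1, z.2 i)) fun _ => hm.aemeasurable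
  rw [this]
  congr 1
  ext1 k
  exact F.particleLaw_map hdens hpot hN t x i

theorem integral_pi_particleLaw (hdens : ∀ (t : ℕ) (x x' : X), 0 < F.dens t x' x)
    (hpot : ∀ (t : ℕ) (x : X), 0 < F.pot t x) (hN : 0 < N) (t : ℕ) (x : Fin N → X) (i : Fin M)
    {f : (Fin N → X × Fin N) → ℝ} (hf : Measurable f) :
    ∫ z, f (fun k => ((z k).1, (z k).2 i)) ∂(Measure.pi fun _ : Fin N => F.particleLaw M t x) =
      ∫ z, f z ∂(Measure.pi fun _ : Fin N => F.ancestorLaw t x) := by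
  rw [← F.pi_particleLaw_map hdens hpot hN t x i, integral_map]
  · exact (by fun_prop : Measurable fun (z : Fin N → X × (Fin M → Fin N)) k =>
      ((z k).1, (z k).2 i)).aemeasurable
  · exact hf.aestronglyMeasurable

end Model

end PaRIS

namespace PaRIS

/-! ## One step of the backward statistics -/

section Stat

variable {N M : ℕ}

/-- The indicator of the pairs of indices selected by a bit. -/
def sel (c : Fin 2) (k l : Fin N) : ℝ :=
  if c = 0 then (if k ≠ l then 1 else 0) else (if k = l then 1 else 0)

/-- The average over the backward indices `u`, `v` of two particles in the recursion of the
backward statistics. -/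
def pairStat (c : Fin 2) (W : Fin N → ℝ) (T : Fin N → Fin N → ℝ) (u v : Fin M → Fin N) : ℝ :=
  if c = 0 then (∑ i, T (u i) (v i)) / M else (∑ i, ∑ j, W j * T (u i) j) / M

/-- One step of the recursion of the backward statistics. -/
def nextStat (c : Fin 2) (W : Fin N → ℝ) (T : Fin N → Fin N → ℝ) (J : Fin N → Fin M → Fin N)
    (k l : Fin N) : ℝ :=
  sel c k l * pairStat c W T (J k) (J l)

/-- The sum of the squares of the row sums. -/
def rowSq (T : Fin N → Fin N → ℝ) : ℝ := ∑ k, (∑ l, T k l) ^ 2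

/-- The normalizing factor attached to a bit. -/
def bitFactor (N : ℕ) (c : Fin 2) : ℝ := (N : ℝ) ^ (c : ℕ) * ((N : ℝ) / (N - 1)) ^ (1 - (c : ℕ))

theorem sel_nonneg (c : Fin 2) (k l : Fin N) : 0 ≤ sel c k l := by
  unfold sel; split_ifs <;> norm_num

theorem sel_le_one (c : Fin 2) (k l : Fin N) : sel c k l ≤ 1 := by
  unfold sel; split_ifs <;> norm_num

theorem sel_comm (c : Fin 2) (k l : Fin N) : sel c k l = sel c l k := by
  unfold sel
  simp only [eq_comm, ne_eq]

/-- `bitFactor` is `N ^ 2` divided by the number of selected pairs: `N * (N - 1)` off the diagonal,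
`N` on it. This is what makes the recursion of conditional means exact. -/
theorem sum_sel_mul_bitFactor (hN : 2 ≤ N) (c : Fin 2) :
    bitFactor N c * ∑ k : Fin N, ∑ l : Fin N, sel c k l = (N : ℝ) ^ 2 := by
  have hN1 : ((N : ℝ) - 1) ≠ 0 := by
    have : (2 : ℝ) ≤ N := by exact_mod_cast hN
    linarith
  fin_cases c
  · have : ∀ k : Fin N, ∑ l : Fin N, (if k = l then (0 : ℝ) else 1) = N - 1 := fun k => by
      have : ∀ l, (if k = l then (0 : ℝ) else 1) = 1 - if k = l then 1 else 0 := fun l => by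
        split_ifs <;> norm_num
      simp only [this, Finset.sum_sub_distrib]
      simp
    simp [bitFactor, sel, this]
    field_simp
  · simp [bitFactor, sel, pow_two]

theorem bitFactor_zero_le (hN : 2 ≤ N) : bitFactor N 0 ≤ 2 := by
  have : (2 : ℝ) ≤ N := by exact_mod_cast hN
  simp only [bitFactor, Fin.val_zero, pow_zero, one_mul, tsub_zero, pow_one]
  rw [div_le_iff₀ (by linarith)]
  linarith

theorem bitFactor_one : bitFactor N 1 = N := by simp [bitFactor]

theorem bitFactor_nonneg (hN : 2 ≤ N) (c : Fin 2) : 0 ≤ bitFactor N c := by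
  have : (2 : ℝ) ≤ N := by exact_mod_cast hN
  exact mul_nonneg (by positivity) (pow_nonneg (div_nonneg (by positivity) (by linarith)) _)

variable {c : Fin 2} {W : Fin N → ℝ} {T : Fin N → Fin N → ℝ}

theorem pairStat_nonneg (hW : ∀ j, 0 ≤ W j) (hT : ∀ k l, 0 ≤ T k l) (u v : Fin M → Fin N) :
    0 ≤ pairStat c W T u v := by
  unfold pairStat
  split_ifs
  · exact div_nonneg (Finset.sum_nonneg fun _ _ => hT _ _) (Nat.cast_nonneg _)
  · exact div_nonneg (Finset.sum_nonneg fun _ _ => Finset.sum_nonneg fun _ _ =>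
      mul_nonneg (hW _) (hT _ _)) (Nat.cast_nonneg _)

theorem nextStat_nonneg (hW : ∀ j, 0 ≤ W j) (hT : ∀ k l, 0 ≤ T k l)
    (J : Fin N → Fin M → Fin N) (k l : Fin N) : 0 ≤ nextStat c W T J k l :=
  mul_nonneg (sel_nonneg _ _ _) (pairStat_nonneg hW hT _ _)

/-- For the bit `1`, `pairStat` is not symmetric in its two arguments, but `sel` kills everything
off the diagonal. Symmetry lets column sums be bounded by row sums later. -/
theorem nextStat_comm (hT : ∀ k l, T k l = T l k) (J : Fin N → Fin M → Fin N) (k l : Fin N) :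
    nextStat c W T J k l = nextStat c W T J l k := by
  unfold nextStat
  rw [sel_comm]
  by_cases hc : c = 0
  · simp only [pairStat, if_pos hc]
    rw [Finset.sum_congr rfl fun i _ => hT (J k i) (J l i)]
  · by_cases hkl : l = k
    · rw [hkl]
    · simp [sel, hc, hkl]

theorem rowSq_nonneg (T : Fin N → Fin N → ℝ) : 0 ≤ rowSq T :=
  Finset.sum_nonneg fun _ _ => sq_nonneg _

theorem sum_sq_le_rowSq (hT : ∀ k l, 0 ≤ T k l) : ∑ k, ∑ l, T k l ^ 2 ≤ rowSq T :=
  Finset.sum_le_sum fun k _ => Finset.sum_sq_le_sq_sum_of_nonneg fun l _ => hT k l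

end Stat

variable {X : Type u} [MeasurableSpace X]

namespace Model

variable (F : Model X) {N M : ℕ}

theorem biTrans_zero (t : ℕ) (x x' : X) :
    F.biTrans t 0 (x, x') = (F.trans t x).prod (F.trans t x') := by
  simp [biTrans, Kernel.parallelComp_apply]

theorem biTrans_one (t : ℕ) (x x' : X) :
    F.biTrans t 1 (x, x') = (F.trans t x).map fun z => (z, z) := by
  simp only [biTrans, Fin.one_eq_zero_iff, OfNat.ofNat_ne_one, if_false]
  rw [Kernel.map_apply _ (by fun_prop : Measurable fun z : X => (z, z)), Kernel.comap_apply]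

instance isMarkovKernel_biTrans (t : ℕ) (c : Fin 2) : IsMarkovKernel (F.biTrans t c) := by
  unfold biTrans
  split_ifs
  · infer_instance
  · exact Kernel.IsMarkovKernel.map _ (by fun_prop : Measurable fun z : X => (z, z))

/-! ### Conditional moments given the previous particles -/

section OneStep

variable (hdens : ∀ (t : ℕ) (x x' : X), 0 < F.dens t x' x) (hpot : ∀ (t : ℕ) (x : X), 0 < F.pot t x)
  (hN : 0 < N) (hM : 0 < M) (t : ℕ) (x : Fin N → X) (T : Fin N → Fin N → ℝ)

theorem bddMeas_snd (f : Fin N → ℝ) : BddMeas fun z : X × Fin N => f z.2 :=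
  (BddMeas.of_countable f).comp measurable_snd

theorem bddMeas_snd_snd (f : Fin N → Fin N → ℝ) :
    BddMeas fun z : (X × Fin N) × (X × Fin N) => f z.1.2 z.2.2 :=
  (BddMeas.of_countable fun p : Fin N × Fin N => f p.1 p.2).comp
    (g := fun z : (X × Fin N) × (X × Fin N) => (z.1.2, z.2.2)) (by fun_prop)

include hpot hN

theorem integral_pair_ancestorLaw {k l : Fin N} (hkl : k ≠ l) {h : X × X → ℝ} (hh : BddMeas h) :
    ∫ z, T (z k).2 (z l).2 * h ((z k).1, (z l).1) ∂(Measure.pi fun _ : Fin N => F.ancestorLaw t x) =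
      ∑ m, ∑ n, F.weight t x m * F.weight t x n * T m n * ∫ p, h p ∂(F.biTrans t 0 (x m, x n)) := by
  have := F.isProbabilityMeasure_ancestorLaw hpot hN t x
  have hb : BddMeas fun p : (X × Fin N) × (X × Fin N) => T p.1.2 p.2.2 * h (p.1.1, p.2.1) :=
    (bddMeas_snd_snd T).mul (hh.comp (by fun_prop))
  have h1 := integral_map (μ := Measure.pi fun _ : Fin N => F.ancestorLaw t x)
    (φ := fun z => (z k, z l)) (f := fun p => T p.1.2 p.2.2 * h (p.1.1, p.2.1))
    ((measurable_pi_apply k).prodMk (measurable_pi_apply l)).aemeasurable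
    hb.meas.aestronglyMeasurable
  rw [← h1, pi_map_pair _ hkl, integral_prod _ (hb.integrable _)]
  have h2 : ∀ u : X × Fin N, ∫ v, T u.2 v.2 * h (u.1, v.1) ∂(F.ancestorLaw t x) =
      ∑ n, F.weight t x n * (T u.2 n * ∫ y, h (u.1, y) ∂(F.trans t (x n))) := by
    intro u
    rw [F.integral_ancestorLaw t x (hb.comp (measurable_prodMk_left (x := u)))]
    simp only [integral_const_mul]
  simp only [h2]
  have hin : ∀ n, BddMeas fun u : X => ∫ y, h (u, y) ∂(F.trans t (x n)) := fun n =>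
    BddMeas.integral_kernel (κ := Kernel.const X (F.trans t (x n))) hh
  rw [F.integral_ancestorLaw t x]
  · refine Finset.sum_congr rfl fun m _ => ?_
    rw [integral_finsetSum _ fun n _ =>
      (((BddMeas.const (T m n)).mul (hin n)).integrable _).const_mul _, Finset.mul_sum]
    refine Finset.sum_congr rfl fun n _ => ?_
    rw [integral_const_mul, integral_const_mul, biTrans_zero, integral_prod _ (hh.integrable _)]
    ring
  · exact BddMeas.sum _ fun n _ => (BddMeas.const _).mul
      ((bddMeas_snd fun m => T m n).mul ((hin n).comp measurable_fst))

theorem integral_diag_ancestorLaw (k : Fin N) (a : Fin N → ℝ) {h : X × X → ℝ} (hh : BddMeas h) :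
    ∫ z, a (z k).2 * h ((z k).1, (z k).1) ∂(Measure.pi fun _ : Fin N => F.ancestorLaw t x) =
      ∑ m, F.weight t x m * (a m * ∫ y, h (y, y) ∂(F.trans t (x m))) := by
  have := F.isProbabilityMeasure_ancestorLaw hpot hN t x
  have hb : BddMeas fun u : X × Fin N => a u.2 * h (u.1, u.1) :=
    (bddMeas_snd a).mul (hh.comp (by fun_prop))
  have h1 := integral_map (μ := Measure.pi fun _ : Fin N => F.ancestorLaw t x)
    (φ := fun z => z k) (f := fun u => a u.2 * h (u.1, u.1))
    (measurable_pi_apply k).aemeasurable hb.meas.aestronglyMeasurable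
  have h2 := (measurePreserving_eval (fun _ : Fin N => F.ancestorLaw t x) k).map_eq
  rw [← h1, show (fun z : Fin N → X × Fin N => z k) = Function.eval k from rfl, h2,
    F.integral_ancestorLaw t x hb]
  simp only [integral_const_mul]

/-- Given the ancestor of `k`, the ancestors of `l` and `l'` are independent and each contributes
the same weighted row sum; hence the square. -/
theorem integral_triple_ancestorLaw {k l l' : Fin N} (hkl : k ≠ l) (hkl' : k ≠ l') (hl : l ≠ l') :
    ∫ z, T (z k).2 (z l).2 * T (z k).2 (z l').2
        ∂(Measure.pi fun _ : Fin N => F.ancestorLaw t x) =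
      ∑ m, F.weight t x m * (∑ n, F.weight t x n * T m n) ^ 2 := by
  have := F.isProbabilityMeasure_ancestorLaw hpot hN t x
  have hb : BddMeas fun p : ((X × Fin N) × (X × Fin N)) × (X × Fin N) =>
      T p.1.1.2 p.1.2.2 * T p.1.1.2 p.2.2 :=
    ((bddMeas_snd_snd T).comp measurable_fst).mul
      ((bddMeas_snd_snd T).comp (by fun_prop :
        Measurable fun p : ((X × Fin N) × (X × Fin N)) × (X × Fin N) => (p.1.1, p.2)))
  have h1 := integral_map (μ := Measure.pi fun _ : Fin N => F.ancestorLaw t x)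
    (φ := fun z => ((z k, z l), z l')) (f := fun p => T p.1.1.2 p.1.2.2 * T p.1.1.2 p.2.2)
    (((measurable_pi_apply k).prodMk (measurable_pi_apply l)).prodMk
      (measurable_pi_apply l')).aemeasurable
    hb.meas.aestronglyMeasurable
  have hrow : ∀ m, ∫ v, T m v.2 ∂(F.ancestorLaw t x) = ∑ n, F.weight t x n * T m n := by
    intro m
    rw [F.integral_ancestorLaw t x (bddMeas_snd (T m))]
    simp
  rw [← h1, pi_map_triple _ hkl hkl' hl, integral_prod _ (hb.integrable _)]
  simp only [integral_const_mul, hrow]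
  have hb2 : BddMeas fun p : (X × Fin N) × (X × Fin N) =>
      T p.1.2 p.2.2 * ∑ n, F.weight t x n * T p.1.2 n :=
    (bddMeas_snd_snd T).mul
      ((bddMeas_snd fun m => ∑ n, F.weight t x n * T m n).comp measurable_fst)
  rw [integral_prod _ (hb2.integrable _)]
  simp only [integral_mul_const, hrow]
  rw [F.integral_ancestorLaw t x
    (bddMeas_snd fun m => (∑ n, F.weight t x n * T m n) * ∑ n, F.weight t x n * T m n)]
  simp [pow_two]

/-- Expanding the square over `l`, `l'`: at most `N ^ 2` terms with three distinct indices give the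
first sum, and at most `N` terms with `l = l'` give the second. Terms in which `k` recurs vanish. -/
theorem integral_sq_offDiag_le (k : Fin N) :
    ∫ z, (∑ l, sel 0 k l * T (z k).2 (z l).2) ^ 2
        ∂(Measure.pi fun _ : Fin N => F.ancestorLaw t x) ≤
      N ^ 2 * (∑ m, F.weight t x m * (∑ n, F.weight t x n * T m n) ^ 2) +
        N * ∑ m, ∑ n, F.weight t x m * F.weight t x n * T m n ^ 2 := by
  have := F.isProbabilityMeasure_ancestorLaw hpot hN t x
  set Q1 := ∑ m, F.weight t x m * (∑ n, F.weight t x n * T m n) ^ 2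
  set Q2 := ∑ m, ∑ n, F.weight t x m * F.weight t x n * T m n ^ 2
  have hQ1 : 0 ≤ Q1 := Finset.sum_nonneg fun m _ =>
    mul_nonneg (F.weight_nonneg _ _ _) (sq_nonneg _)
  have hQ2 : 0 ≤ Q2 := Finset.sum_nonneg fun m _ => Finset.sum_nonneg fun n _ =>
    mul_nonneg (mul_nonneg (F.weight_nonneg _ _ _) (F.weight_nonneg _ _ _)) (sq_nonneg _)
  have hTm : ∀ l, BddMeas fun z : Fin N → X × Fin N => sel 0 k l * T (z k).2 (z l).2 := fun l =>
    (BddMeas.const _).mul ((bddMeas_snd_snd T).comp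
      (g := fun z : Fin N → X × Fin N => (z k, z l)) (by fun_prop))
  simp only [pow_two (∑ l, sel 0 k l * _), Finset.sum_mul_sum]
  rw [integral_finsetSum _ fun l _ => integrable_finsetSum _ fun l' _ =>
    ((hTm l).mul (hTm l')).integrable _]
  have hle : ∀ l l', ∫ z, sel 0 k l * T (z k).2 (z l).2 * (sel 0 k l' * T (z k).2 (z l').2)
      ∂(Measure.pi fun _ : Fin N => F.ancestorLaw t x) ≤ Q1 + if l = l' then Q2 else 0 := by
    intro l l'
    by_cases hkl : k = l
    · have : 0 ≤ if l = l' then Q2 else 0 := by split_ifs <;> simp [hQ2]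
      simp only [sel, hkl]
      simp only [ne_eq, not_true_eq_false, if_false, if_true, zero_mul, integral_zero]
      linarith
    by_cases hkl' : k = l'
    · have : 0 ≤ if l = l' then Q2 else 0 := by split_ifs <;> simp [hQ2]
      simp only [sel, hkl']
      simp only [ne_eq, not_true_eq_false, if_false, if_true, zero_mul, mul_zero, integral_zero]
      linarith
    have h0 : sel 0 k l = 1 := by simp [sel, hkl]
    have h0' : sel 0 k l' = 1 := by simp [sel, hkl']
    simp only [h0, h0', one_mul]
    by_cases hl : l = l'
    · subst hl
      rw [if_pos rfl]
      -- The squared entries are treated as a new matrix and the test function is taken to be `1`.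
      have := F.integral_pair_ancestorLaw hpot hN t x (fun m n => T m n * T m n) hkl
        (BddMeas.const 1)
      simp only [mul_one, integral_const, probReal_univ, smul_eq_mul] at this
      rw [this]
      simp only [← pow_two]
      linarith
    · rw [if_neg hl, F.integral_triple_ancestorLaw hpot hN t x T hkl hkl' hl, add_zero]
  calc _ ≤ ∑ l : Fin N, ∑ l' : Fin N, (Q1 + if l = l' then Q2 else 0) := by
        refine Finset.sum_le_sum fun l _ => ?_
        rw [integral_finsetSum _ fun l' _ => ((hTm l).mul (hTm l')).integrable _]
        exact Finset.sum_le_sum fun l' _ => hle l l'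
    _ = _ := by
        simp only [Finset.sum_add_distrib]
        simp
        ring

include hdens hM

/-- By linearity each backward index can be treated alone, and its law is that of an ancestor, so
the dependence among the `M` indices of one particle is irrelevant here. The result is `sel c k l`
times a number independent of `k`, `l`, the form of mean required by `variance_pair_sum_le`. -/
theorem integral_nextStat (c : Fin 2) (k l : Fin N) {h : X × X → ℝ} (hh : BddMeas h) :
    ∫ z, nextStat c (F.weight t x) T (fun k => (z k).2) k l * h ((z k).1, (z l).1)
        ∂(Measure.pi fun _ : Fin N => F.particleLaw M t x) =
      sel c k l * ∑ m, ∑ n, F.weight t x m * F.weight t x n * T m n *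
        ∫ p, h p ∂(F.biTrans t c (x m, x n)) := by
  have := F.isProbabilityMeasure_particleLaw (M := M) hdens hpot hN t x
  have hM' : (M : ℝ) ≠ 0 := by exact_mod_cast hM.ne'
  have hh2 : BddMeas fun z : Fin N → X × (Fin M → Fin N) => h ((z k).1, (z l).1) :=
    hh.comp (by fun_prop)
  simp only [nextStat, mul_assoc (sel c k l)]
  rw [integral_const_mul]
  by_cases hs : sel c k l = 0
  · rw [hs, zero_mul, zero_mul]
  congr 1
  by_cases hc : c = 0
  · subst hc
    have hkl : k ≠ l := fun h => hs (by simp [sel, h])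
    simp only [pairStat, if_true, Finset.sum_div, Finset.sum_mul]
    have hi : ∀ i : Fin M, ∫ z, T ((z k).2 i) ((z l).2 i) / M * h ((z k).1, (z l).1)
        ∂(Measure.pi fun _ : Fin N => F.particleLaw M t x) = (M : ℝ)⁻¹ *
        ∑ m, ∑ n, F.weight t x m * F.weight t x n * T m n *
          ∫ p, h p ∂(F.biTrans t 0 (x m, x n)) := by
      intro i
      rw [← F.integral_pair_ancestorLaw hpot hN t x T hkl hh,
        ← F.integral_pi_particleLaw hdens hpot hN t x i, ← integral_const_mul]
      · congr 1; ext z; ring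
      · exact (((bddMeas_snd_snd T).mul (hh.comp (g := fun p : (X × Fin N) × (X × Fin N) =>
          (p.1.1, p.2.1)) (by fun_prop))).comp
          (g := fun z : Fin N → X × Fin N => (z k, z l)) (by fun_prop)).meas
    rw [integral_finsetSum]
    · simp only [hi, Finset.sum_const, Finset.card_univ, Fintype.card_fin, nsmul_eq_mul]
      rw [mul_inv_cancel_left₀ hM']
    · intro i _
      refine BddMeas.integrable (BddMeas.mul ?_ hh2) _
      exact (BddMeas.of_countable fun p : Fin N × Fin N => T p.1 p.2 / M).comp
        (g := fun z : Fin N → X × (Fin M → Fin N) => ((z k).2 i, (z l).2 i)) (by fun_prop)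
  · have hc1 : c = 1 := by omega
    subst hc1
    have hkl : k = l := by
      by_contra h
      exact hs (by simp [sel, h])
    subst hkl
    simp only [pairStat, hc, if_false, Finset.sum_div (s := (Finset.univ : Finset (Fin M))),
      Finset.sum_mul (s := (Finset.univ : Finset (Fin M)))]
    have hi : ∀ i : Fin M, ∫ z, (∑ j, F.weight t x j * T ((z k).2 i) j) / M *
          h ((z k).1, (z k).1)
        ∂(Measure.pi fun _ : Fin N => F.particleLaw M t x) = (M : ℝ)⁻¹ *
        ∑ m, ∑ n, F.weight t x m * F.weight t x n * T m n *
          ∫ p, h p ∂(F.biTrans t 1 (x m, x n)) := by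
      intro i
      have h1 := F.integral_diag_ancestorLaw hpot hN t x k
        (fun m => ∑ j, F.weight t x j * T m j) hh
      rw [← F.integral_pi_particleLaw hdens hpot hN t x i] at h1
      · have h2 : ∀ m n, ∫ p, h p ∂(F.biTrans t 1 (x m, x n)) =
            ∫ y, h (y, y) ∂(F.trans t (x m)) := by
          intro m n
          rw [biTrans_one, integral_map (by fun_prop) hh.meas.aestronglyMeasurable]
        simp only [h2]
        have h3 : ∀ m, ∑ n, F.weight t x m * F.weight t x n * T m n *
            ∫ y, h (y, y) ∂(F.trans t (x m)) = F.weight t x m *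
              ((∑ n, F.weight t x n * T m n) * ∫ y, h (y, y) ∂(F.trans t (x m))) := by
          intro m
          rw [Finset.sum_mul, Finset.mul_sum]
          exact Finset.sum_congr rfl fun n _ => by ring
        simp only [h3]
        rw [← h1, ← integral_const_mul]
        congr 1; ext z; ring
      · exact (((bddMeas_snd fun m => ∑ j, F.weight t x j * T m j).mul
          (hh.comp (g := fun p : X × Fin N => (p.1, p.1)) (by fun_prop))).comp
          (g := fun z : Fin N → X × Fin N => z k) (by fun_prop)).meas
    rw [integral_finsetSum]
    · simp only [hi, Finset.sum_const, Finset.card_univ, Fintype.card_fin, nsmul_eq_mul]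
      rw [mul_inv_cancel_left₀ hM']
    · intro i _
      refine BddMeas.integrable (BddMeas.mul ?_ hh2) _
      exact (BddMeas.of_countable fun m : Fin N => (∑ j, F.weight t x j * T m j) / M).comp
        (g := fun z : Fin N → X × (Fin M → Fin N) => (z k).2 i) (by fun_prop)

end OneStep

/-! ### Conditional variance and propagation of the row sums -/

section OneStep

variable (hdens : ∀ (t : ℕ) (x x' : X), 0 < F.dens t x' x) (hpot : ∀ (t : ℕ) (x : X), 0 < F.pot t x)
  (hN : 0 < N) (hM : 0 < M) (t : ℕ) (x : Fin N → X) (T : Fin N → Fin N → ℝ)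

/-- The function of two particles and of their backward indices whose sum over all pairs of
particles is the estimator. -/
def pairTerm (c : Fin 2) (h : X × X → ℝ) (k l : Fin N)
    (p : (X × (Fin M → Fin N)) × (X × (Fin M → Fin N))) : ℝ :=
  sel c k l * pairStat c (F.weight t x) T p.1.2 p.2.2 * h (p.1.1, p.2.1)

theorem bddMeas_pairTerm (c : Fin 2) {h : X × X → ℝ} (hh : BddMeas h) (k l : Fin N) :
    BddMeas (F.pairTerm (M := M) t x T c h k l) := by
  unfold pairTerm
  refine BddMeas.mul ((BddMeas.const _).mul ?_) (hh.comp (by fun_prop))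
  exact (BddMeas.of_countable fun p : (Fin M → Fin N) × (Fin M → Fin N) =>
    pairStat c (F.weight t x) T p.1 p.2).comp
    (g := fun p : (X × (Fin M → Fin N)) × (X × (Fin M → Fin N)) => (p.1.2, p.2.2)) (by fun_prop)

theorem bddMeas_nextStat (c : Fin 2) (k l : Fin N) :
    BddMeas fun z : Fin N → X × (Fin M → Fin N) =>
      nextStat c (F.weight t x) T (fun k => (z k).2) k l := by
  have := (F.bddMeas_pairTerm (M := M) t x T c (BddMeas.const 1) k l).comp
    (g := fun z : Fin N → X × (Fin M → Fin N) => (z k, z l)) (by fun_prop)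
  simpa [pairTerm, nextStat] using this

include hdens hpot hN hM

theorem variance_sum_pairTerm_le (hT : ∀ k l, 0 ≤ T k l) (hT' : ∀ k l, T k l = T l k) (c : Fin 2)
    {h : X × X → ℝ} (hh : BddMeas h) {H : ℝ} (hH : ∀ p, |h p| ≤ H) :
    Var[fun z => ∑ p : Fin N × Fin N, F.pairTerm t x T c h p.1 p.2 (z p.1, z p.2);
        Measure.pi fun _ : Fin N => F.particleLaw M t x] ≤
      4 * H ^ 2 * ∫ z, rowSq (nextStat c (F.weight t x) T fun k => (z k).2)
        ∂(Measure.pi fun _ : Fin N => F.particleLaw M t x) := by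
  have := F.isProbabilityMeasure_particleLaw (M := M) hdens hpot hN t x
  refine (variance_pair_sum_le (F.particleLaw M t x) (F.pairTerm t x T c h)
    (F.bddMeas_pairTerm t x T c hh) (sel_nonneg c)
    (fun k l => F.integral_nextStat hdens hpot hN hM t x T c k l hh)).trans ?_
  rw [← integral_const_mul]
  have hτ : ∀ (z : Fin N → X × (Fin M → Fin N)) k l,
      0 ≤ nextStat c (F.weight t x) T (fun k => (z k).2) k l := fun z k l =>
    nextStat_nonneg (F.weight_nonneg t x) hT _ k l
  have hle : ∀ (z : Fin N → X × (Fin M → Fin N)) k l, |F.pairTerm t x T c h k l (z k, z l)| ≤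
      H * nextStat c (F.weight t x) T (fun k => (z k).2) k l := by
    intro z k l
    have : F.pairTerm t x T c h k l (z k, z l) =
      nextStat c (F.weight t x) T (fun k => (z k).2) k l * h ((z k).1, (z l).1) := rfl
    rw [this, abs_mul, abs_of_nonneg (hτ z k l), mul_comm]
    exact mul_le_mul_of_nonneg_right (hH _) (hτ z k l)
  refine integral_mono ?_ ?_ fun z => ?_
  · have hb : ∀ k l, BddMeas fun z : Fin N → X × (Fin M → Fin N) =>
        |F.pairTerm t x T c h k l (z k, z l)| := fun k l =>
      ((F.bddMeas_pairTerm t x T c hh k l).comp (by fun_prop)).abs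
    exact (BddMeas.sum _ fun j _ => ((BddMeas.sum _ fun l _ => hb j l).add
      (BddMeas.sum _ fun l _ => hb l j)).pow 2).integrable _
  · exact ((BddMeas.const _).mul (BddMeas.sum _ fun j _ => (BddMeas.sum _ fun l _ =>
      F.bddMeas_nextStat t x T c j l).pow 2)).integrable _
  · simp only [rowSq, Finset.mul_sum]
    refine Finset.sum_le_sum fun j _ => ?_
    -- Row and column sums coincide by symmetry of the statistics; the resulting factor `2 * H`
    -- squares to `4 * H ^ 2`.
    have h1 : ∑ l, |F.pairTerm t x T c h j l (z j, z l)| +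
        ∑ l, |F.pairTerm t x T c h l j (z l, z j)| ≤
        2 * H * ∑ l, nextStat c (F.weight t x) T (fun k => (z k).2) j l := by
      have ha : ∑ l, |F.pairTerm t x T c h j l (z j, z l)| ≤
          H * ∑ l, nextStat c (F.weight t x) T (fun k => (z k).2) j l := by
        rw [Finset.mul_sum]; exact Finset.sum_le_sum fun l _ => hle z j l
      have hb : ∑ l, |F.pairTerm t x T c h l j (z l, z j)| ≤
          H * ∑ l, nextStat c (F.weight t x) T (fun k => (z k).2) j l := by
        rw [Finset.mul_sum]
        exact Finset.sum_le_sum fun l _ => (hle z l j).trans_eq (by rw [nextStat_comm hT'])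
      linarith
    refine (pow_le_pow_left₀ (by positivity) h1 2).trans_eq (by ring)

/-- The row sum is an average over the `M` index draws. Convexity of the square bounds its second
moment by that of a single draw, where the indices are i.i.d. ancestors, so the bound does not
depend on `M`. -/
theorem integral_rowSq_zero_le :
    ∫ z, rowSq (nextStat 0 (F.weight t x) T fun k => (z k).2)
        ∂(Measure.pi fun _ : Fin N => F.particleLaw M t x) ≤
      N * (N ^ 2 * (∑ m, F.weight t x m * (∑ n, F.weight t x n * T m n) ^ 2) +
        N * ∑ m, ∑ n, F.weight t x m * F.weight t x n * T m n ^ 2) := by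
  have := F.isProbabilityMeasure_particleLaw (M := M) hdens hpot hN t x
  have hM' : (0 : ℝ) < M := by exact_mod_cast hM
  simp only [rowSq]
  rw [integral_finsetSum _ fun k _ => ((BddMeas.sum _ fun l _ =>
      F.bddMeas_nextStat t x T 0 k l).pow 2).integrable _]
  refine (Finset.sum_le_card_nsmul _ _ _ fun k _ => ?_).trans_eq
    (by rw [Finset.card_univ, Fintype.card_fin, nsmul_eq_mul])
  have hbk : ∀ k, BddMeas fun z : Fin N → X × Fin N =>
      (∑ l, sel 0 k l * T (z k).2 (z l).2) ^ 2 := fun k =>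
    (BddMeas.sum _ fun l _ => (BddMeas.const _).mul ((bddMeas_snd_snd T).comp
      (g := fun z : Fin N → X × Fin N => (z k, z l)) (by fun_prop))).pow 2
  have hbi : ∀ i : Fin M, BddMeas fun z : Fin N → X × (Fin M → Fin N) =>
      (∑ l, sel 0 k l * T ((z k).2 i) ((z l).2 i)) ^ 2 := fun i =>
    (hbk k).comp (g := fun (z : Fin N → X × (Fin M → Fin N)) k => ((z k).1, (z k).2 i))
      (by fun_prop)
  have hjensen : ∀ z : Fin N → X × (Fin M → Fin N),
      (∑ l, nextStat 0 (F.weight t x) T (fun k => (z k).2) k l) ^ 2 ≤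
        (M : ℝ)⁻¹ * ∑ i, (∑ l, sel 0 k l * T ((z k).2 i) ((z l).2 i)) ^ 2 := by
    intro z
    have h1 : ∑ l, nextStat 0 (F.weight t x) T (fun k => (z k).2) k l =
        (M : ℝ)⁻¹ * ∑ i, ∑ l, sel 0 k l * T ((z k).2 i) ((z l).2 i) := by
      rw [Finset.sum_comm, Finset.mul_sum]
      refine Finset.sum_congr rfl fun l _ => ?_
      rw [nextStat, pairStat, if_pos rfl, ← Finset.mul_sum]
      ring
    have h2 := sq_sum_le_card_mul_sum_sq (s := (Finset.univ : Finset (Fin M)))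
      (f := fun i => ∑ l, sel 0 k l * T ((z k).2 i) ((z l).2 i))
    rw [Finset.card_univ, Fintype.card_fin] at h2
    rw [h1, mul_pow]
    calc _ ≤ ((M : ℝ)⁻¹) ^ 2 * (M * ∑ i, (∑ l, sel 0 k l * T ((z k).2 i) ((z l).2 i)) ^ 2) :=
          mul_le_mul_of_nonneg_left h2 (by positivity)
      _ = _ := by field_simp
  refine (integral_mono ((BddMeas.sum _ fun l _ =>
      F.bddMeas_nextStat t x T 0 k l).pow 2 |>.integrable _)
      (((BddMeas.const _).mul (BddMeas.sum _ fun i _ => hbi i)).integrable _) hjensen).trans ?_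
  rw [integral_const_mul, integral_finsetSum _ fun i _ => (hbi i).integrable _]
  have hi : ∀ i : Fin M, ∫ z, (∑ l, sel 0 k l * T ((z k).2 i) ((z l).2 i)) ^ 2
        ∂(Measure.pi fun _ : Fin N => F.particleLaw M t x) ≤ _ := fun i =>
    (F.integral_pi_particleLaw hdens hpot hN t x i (hbk k).meas).trans_le
      (F.integral_sq_offDiag_le hpot hN t x T k)
  rw [inv_mul_le_iff₀ hM']
  exact (Finset.sum_le_card_nsmul _ _ _ fun i _ => hi i).trans_eq
    (by rw [Finset.card_univ, Fintype.card_fin, nsmul_eq_mul])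

/-- Each row has only its diagonal entry, so the row sum is an average of `a` at the `M` backward
indices, and Jensen's inequality again reduces it to one ancestor. -/
theorem integral_rowSq_one_le :
    ∫ z, rowSq (nextStat 1 (F.weight t x) T fun k => (z k).2)
        ∂(Measure.pi fun _ : Fin N => F.particleLaw M t x) ≤
      N * ∑ m, F.weight t x m * (∑ n, F.weight t x n * T m n) ^ 2 := by
  have := F.isProbabilityMeasure_particleLaw (M := M) hdens hpot hN t x
  have hM' : (0 : ℝ) < M := by exact_mod_cast hM
  set a : Fin N → ℝ := fun m => ∑ n, F.weight t x n * T m n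
  simp only [rowSq]
  rw [integral_finsetSum _ fun k _ => ((BddMeas.sum _ fun l _ =>
      F.bddMeas_nextStat t x T 1 k l).pow 2).integrable _]
  refine (Finset.sum_le_card_nsmul _ _ _ fun k _ => ?_).trans_eq
    (by rw [Finset.card_univ, Fintype.card_fin, nsmul_eq_mul])
  have hbk : BddMeas fun z : Fin N → X × Fin N => a (z k).2 ^ 2 :=
    (bddMeas_snd fun m => a m ^ 2).comp (g := fun z : Fin N → X × Fin N => z k) (by fun_prop)
  have hbi : ∀ i : Fin M, BddMeas fun z : Fin N → X × (Fin M → Fin N) =>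
      a ((z k).2 i) ^ 2 := fun i =>
    hbk.comp (g := fun (z : Fin N → X × (Fin M → Fin N)) k => ((z k).1, (z k).2 i))
      (by fun_prop)
  have hjensen : ∀ z : Fin N → X × (Fin M → Fin N),
      (∑ l, nextStat 1 (F.weight t x) T (fun k => (z k).2) k l) ^ 2 ≤
        (M : ℝ)⁻¹ * ∑ i, a ((z k).2 i) ^ 2 := by
    intro z
    have h1 : ∑ l, nextStat 1 (F.weight t x) T (fun k => (z k).2) k l =
        (M : ℝ)⁻¹ * ∑ i, a ((z k).2 i) := by
      simp [nextStat, sel, pairStat, a]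
      ring
    have h2 := sq_sum_le_card_mul_sum_sq (s := (Finset.univ : Finset (Fin M)))
      (f := fun i => a ((z k).2 i))
    rw [Finset.card_univ, Fintype.card_fin] at h2
    rw [h1, mul_pow]
    calc _ ≤ ((M : ℝ)⁻¹) ^ 2 * (M * ∑ i, a ((z k).2 i) ^ 2) :=
          mul_le_mul_of_nonneg_left h2 (by positivity)
      _ = _ := by field_simp
  refine (integral_mono ((BddMeas.sum _ fun l _ =>
      F.bddMeas_nextStat t x T 1 k l).pow 2 |>.integrable _)
      (((BddMeas.const _).mul (BddMeas.sum _ fun i _ => hbi i)).integrable _) hjensen).trans ?_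
  rw [integral_const_mul, integral_finsetSum _ fun i _ => (hbi i).integrable _]
  have hi : ∀ i : Fin M, ∫ z, a ((z k).2 i) ^ 2
        ∂(Measure.pi fun _ : Fin N => F.particleLaw M t x) =
        ∑ m, F.weight t x m * a m ^ 2 := fun i => by
    rw [F.integral_pi_particleLaw hdens hpot hN t x i hbk.meas]
    simpa using F.integral_diag_ancestorLaw hpot hN t x k (fun m => a m ^ 2) (BddMeas.const 1)
  rw [inv_mul_le_iff₀ hM']
  simp [hi, a]

/-- The one-step bound for the second moments of the row sums of the backward statistics. -/
theorem bitFactor_sq_mul_integral_rowSq_le (hN2 : 2 ≤ N) {G : ℝ} (hG : ∀ x, F.pot t x ≤ G)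
    (hT : ∀ k l, 0 ≤ T k l) (c : Fin 2) :
    bitFactor N c ^ 2 * ((∑ l, F.pot t (x l)) / N) ^ 4 *
      ∫ z, rowSq (nextStat c (F.weight t x) T fun k => (z k).2)
        ∂(Measure.pi fun _ : Fin N => F.particleLaw M t x) ≤ 8 * G ^ 4 * rowSq T := by
  have : Nonempty (Fin N) := ⟨⟨0, hN⟩⟩
  set Ω := ∑ l, F.pot t (x l) with hΩ
  set R := rowSq T with hR
  have hR0 : 0 ≤ R := rowSq_nonneg T
  have hΩ0 : 0 < Ω := Finset.sum_pos (fun _ _ => hpot t _) Finset.univ_nonempty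
  have hN' : (0 : ℝ) < N := by exact_mod_cast hN
  have hG0 : 0 < G := (hpot t (x ⟨0, hN⟩)).trans_le (hG _)
  have hΩN : Ω / N ≤ G := by
    rw [div_le_iff₀ hN', mul_comm]
    exact (Finset.sum_le_card_nsmul _ _ _ fun i _ => hG (x i)).trans_eq
      (by rw [Finset.card_univ, Fintype.card_fin, nsmul_eq_mul])
  have hΩN0 : 0 ≤ Ω / N := by positivity
  set Q1 := ∑ m, F.weight t x m * (∑ n, F.weight t x n * T m n) ^ 2 with hQ1
  set Q2 := ∑ m, ∑ n, F.weight t x m * F.weight t x n * T m n ^ 2 with hQ2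
  have hW : ∀ m, F.weight t x m ≤ G / Ω := fun m =>
    div_le_div_of_nonneg_right (hG _) hΩ0.le
  have hW0 := F.weight_nonneg t x
  have hQ1le : Q1 ≤ (G / Ω) ^ 3 * R := by
    rw [hQ1, hR, rowSq, Finset.mul_sum]
    refine Finset.sum_le_sum fun m _ => ?_
    have h1 : ∑ n, F.weight t x n * T m n ≤ G / Ω * ∑ n, T m n := by
      rw [Finset.mul_sum]
      exact Finset.sum_le_sum fun n _ => mul_le_mul_of_nonneg_right (hW n) (hT m n)
    have h0 : 0 ≤ ∑ n, F.weight t x n * T m n :=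
      Finset.sum_nonneg fun n _ => mul_nonneg (hW0 n) (hT m n)
    calc _ ≤ G / Ω * (G / Ω * ∑ n, T m n) ^ 2 :=
          mul_le_mul (hW m) (pow_le_pow_left₀ h0 h1 2) (sq_nonneg _) (by positivity)
      _ = _ := by ring
  have hQ2le : Q2 ≤ (G / Ω) ^ 2 * R := by
    refine le_trans ?_ (mul_le_mul_of_nonneg_left (sum_sq_le_rowSq hT) (by positivity))
    simp only [hQ2, Finset.mul_sum]
    refine Finset.sum_le_sum fun m _ => Finset.sum_le_sum fun n _ => ?_
    rw [pow_two (G / Ω)]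
    exact mul_le_mul_of_nonneg_right
      (mul_le_mul (hW m) (hW n) (hW0 n) (by positivity)) (sq_nonneg _)
  -- Three of the four factors `Ω / N` cancel the weights' denominators and `N ^ 3`; the remaining
  -- one is at most `G`. In `hb2` two cancel and two remain.
  have hb1 : (N : ℝ) ^ 3 * ((Ω / N) ^ 4 * Q1) ≤ G ^ 4 * R := by
    calc _ ≤ (N : ℝ) ^ 3 * ((Ω / N) ^ 4 * ((G / Ω) ^ 3 * R)) := by gcongr
      _ = (Ω / N) * (G ^ 3 * R) := by field_simp
      _ ≤ G * (G ^ 3 * R) := by gcongr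
      _ = _ := by ring
  have hb2 : (N : ℝ) ^ 2 * ((Ω / N) ^ 4 * Q2) ≤ G ^ 4 * R := by
    calc _ ≤ (N : ℝ) ^ 2 * ((Ω / N) ^ 4 * ((G / Ω) ^ 2 * R)) := by gcongr
      _ = (Ω / N) ^ 2 * (G ^ 2 * R) := by field_simp
      _ ≤ G ^ 2 * (G ^ 2 * R) := by gcongr
      _ = _ := by ring
  by_cases hc : c = 0
  · subst hc
    -- The constant `8` arises here: `2 ^ 2` from `bitFactor`, times the two contributions `Q1` and
    -- `Q2`.
    calc _ ≤ (2 : ℝ) ^ 2 * (Ω / N) ^ 4 * (N * (N ^ 2 * Q1 + N * Q2)) := by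
          refine mul_le_mul (mul_le_mul_of_nonneg_right ?_ (by positivity))
            (F.integral_rowSq_zero_le hdens hpot hN hM t x T)
            (integral_nonneg fun z => rowSq_nonneg _) (by positivity)
          exact pow_le_pow_left₀ (bitFactor_nonneg hN2 _) (bitFactor_zero_le hN2) 2
      _ = 4 * ((N : ℝ) ^ 3 * ((Ω / N) ^ 4 * Q1)) + 4 * ((N : ℝ) ^ 2 * ((Ω / N) ^ 4 * Q2)) := by
          ring
      _ ≤ _ := by linarith
  · have hc1 : c = 1 := by omega
    subst hc1
    rw [bitFactor_one]
    calc _ ≤ (N : ℝ) ^ 2 * (Ω / N) ^ 4 * (N * Q1) := by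
          refine mul_le_mul_of_nonneg_left
            (F.integral_rowSq_one_le hdens hpot hN hM t x T) (by positivity)
      _ = (N : ℝ) ^ 3 * ((Ω / N) ^ 4 * Q1) := by ring
      _ ≤ _ := by nlinarith [mul_nonneg (pow_nonneg hG0.le 4) hR0]

end OneStep

end Model

end PaRIS

/-! ### Bias–variance identity and measurability of the statistics -/

namespace PaRIS

theorem integral_sq_mul_sub {Ω : Type*} [MeasurableSpace Ω] (P : Measure Ω)
    [IsProbabilityMeasure P] {Y : Ω → ℝ} (hY : BddMeas Y) (a m : ℝ) :
    ∫ z, (a * Y z - m) ^ 2 ∂P = a ^ 2 * Var[Y; P] + (a * ∫ z, Y z ∂P - m) ^ 2 := by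
  rw [variance_eq_sub (hY.memLp 2 P)]
  have h1 : ∀ z, (a * Y z - m) ^ 2 = a ^ 2 * Y z ^ 2 - 2 * a * m * Y z + m ^ 2 := fun z => by ring
  simp only [h1]
  rw [integral_add, integral_sub, integral_const_mul, integral_const_mul]
  · simp
    ring
  · exact ((BddMeas.const _).mul (hY.pow 2)).integrable P
  · exact ((BddMeas.const _).mul hY).integrable P
  · exact (((BddMeas.const _).mul (hY.pow 2)).sub ((BddMeas.const _).mul hY)).integrable P
  · exact integrable_const _

theorem BddMeas.nextStat {α : Type*} [MeasurableSpace α] {N M : ℕ} (c : Fin 2)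
    {W : α → Fin N → ℝ} (hW : ∀ j, BddMeas fun a => W a j)
    {T : α → Fin N → Fin N → ℝ} (hT : ∀ k l, BddMeas fun a => T a k l)
    {J : α → Fin N → Fin M → Fin N} (hJ : Measurable J) (k l : Fin N) :
    BddMeas fun a => nextStat c (W a) (T a) (J a) k l := by
  -- Evaluation at a random index is written as a finite sum over indicators, which keeps it bounded
  -- and measurable.
  have hind : ∀ (k : Fin N) (i : Fin M) (m : Fin N),
      BddMeas fun a => if J a k i = m then (1 : ℝ) else 0 := fun k i m =>
    (BddMeas.of_countable fun n : Fin N => if n = m then (1 : ℝ) else 0).comp (by fun_prop)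
  have h1 : ∀ (i : Fin M) (j : Fin N), BddMeas fun a => T a (J a k i) j := by
    intro i j
    have : ∀ a, T a (J a k i) j = ∑ m, (if J a k i = m then (1 : ℝ) else 0) * T a m j := by
      intro a; simp
    simp only [this]
    exact BddMeas.sum _ fun m _ => (hind k i m).mul (hT m j)
  have h2 : ∀ i : Fin M, BddMeas fun a => T a (J a k i) (J a l i) := by
    intro i
    have : ∀ a, T a (J a k i) (J a l i) =
        ∑ m, (if J a l i = m then (1 : ℝ) else 0) * T a (J a k i) m := by
      intro a; simp
    simp only [this]
    exact BddMeas.sum _ fun m _ => (hind l i m).mul (h1 i m)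
  unfold PaRIS.nextStat pairStat
  simp only [div_eq_mul_inv]
  split_ifs
  · exact (BddMeas.const _).mul ((BddMeas.sum _ fun i _ => h2 i).mul (BddMeas.const _))
  · exact (BddMeas.const _).mul ((BddMeas.sum _ fun i _ => BddMeas.sum _ fun j _ =>
      (hW j).mul (h1 i j)).mul (BddMeas.const _))

variable {X : Type u} [MeasurableSpace X]

namespace Model

variable (F : Model X) {N M : ℕ}

/-! ## The target measures -/

instance isProbabilityMeasure_biInit (c : Fin 2) : IsProbabilityMeasure (F.biInit c) := by
  unfold biInit
  split_ifs
  · infer_instance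
  · exact Measure.isProbabilityMeasure_map (by fun_prop)

/-- The unnormalized bivariate Feynman–Kac operator from functions at time `t + 1` to functions
at time `t`. -/
def biOp (t : ℕ) (c : Fin 2) (h : X × X → ℝ) (z : X × X) : ℝ :=
  F.pot t z.1 * F.pot t z.2 * ∫ p, h p ∂(F.biTrans t c z)

theorem bddMeas_pot {G : ℝ} (hG : ∀ t x, F.pot t x ≤ G) (t : ℕ) : BddMeas (F.pot t) :=
  ⟨F.measurable_pot t, G, fun x => by rw [abs_of_nonneg (F.pot_nonneg t x)]; exact hG t x⟩

theorem bddMeas_biOp {G : ℝ} (hG : ∀ t x, F.pot t x ≤ G) (t : ℕ) (c : Fin 2) {h : X × X → ℝ}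
    (hh : BddMeas h) : BddMeas (F.biOp t c h) := by
  have hp := F.bddMeas_pot hG t
  exact ((hp.comp measurable_fst).mul (hp.comp measurable_snd)).mul
    (BddMeas.integral_kernel (hh.comp measurable_snd) (F.biTrans t c))

theorem isFiniteMeasure_withDensity_pot {G : ℝ} (hG : ∀ t x, F.pot t x ≤ G) (t : ℕ)
    (μ : Measure (Fin (t + 1) → X × X)) [IsFiniteMeasure μ] :
    IsFiniteMeasure (μ.withDensity fun p =>
      ENNReal.ofReal (F.pot t (p (Fin.last t)).1 * F.pot t (p (Fin.last t)).2)) :=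
  isFiniteMeasure_withDensity_ofReal (((((F.bddMeas_pot hG t).comp measurable_fst).mul
    ((F.bddMeas_pot hG t).comp measurable_snd)).comp
      (measurable_pi_apply (Fin.last t))).integrable μ).2

theorem isFiniteMeasure_mu {G : ℝ} (hG : ∀ t x, F.pot t x ≤ G) :
    ∀ (t : ℕ) (b : Fin (t + 1) → Fin 2), IsFiniteMeasure (F.mu t b)
  | 0, b => by unfold mu; infer_instance
  | t + 1, b => by
    have := isFiniteMeasure_mu hG t fun s => b s.castSucc
    have := F.isFiniteMeasure_withDensity_pot hG t (F.mu t fun s => b s.castSucc)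
    unfold mu
    infer_instance

theorem muTerminal_zero (b : Fin 1 → Fin 2) {h : X × X → ℝ} (hh : BddMeas h) :
    F.muTerminal 0 b h = ∫ z, h z ∂(F.biInit (b 0)) := by
  unfold muTerminal mu
  rw [integral_map]
  · exact (measurable_pi_lambda _ fun _ => measurable_id).aemeasurable
  · exact (hh.meas.comp (measurable_pi_apply _)).aestronglyMeasurable

/-- Integrating out the last transition moves it, with the potentials, into the test function;
`parisEstimator` satisfies this recursion in conditional mean. -/
theorem muTerminal_succ {G : ℝ} (hG : ∀ t x, F.pot t x ≤ G) (t : ℕ) (b : Fin (t + 2) → Fin 2)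
    {h : X × X → ℝ} (hh : BddMeas h) :
    F.muTerminal (t + 1) b h =
      F.muTerminal t (fun s => b s.castSucc) (F.biOp t (b (Fin.last (t + 1))) h) := by
  have := F.isFiniteMeasure_mu hG t fun s => b s.castSucc
  have := F.isFiniteMeasure_withDensity_pot hG t (F.mu t fun s => b s.castSucc)
  have hsnoc : Measurable fun q : (Fin (t + 1) → X × X) × (X × X) =>
      (Fin.snoc (α := fun _ => X × X) q.1 q.2 : Fin (t + 2) → X × X) := by
    refine measurable_pi_lambda _ fun i => ?_
    refine Fin.lastCases ?_ (fun j => ?_) i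
    · simpa using measurable_snd
    · simpa [Function.comp_def] using (measurable_pi_apply j).comp measurable_fst
  unfold muTerminal
  have hlast : Measurable fun p : Fin (t + 2) → X × X => h (p (Fin.last (t + 1))) :=
    hh.meas.comp (measurable_pi_apply _)
  rw [mu, integral_map hsnoc.aemeasurable hlast.aestronglyMeasurable]
  simp only [Fin.snoc_last]
  rw [Measure.integral_compProd ((hh.comp measurable_snd).integrable _),
    integral_withDensity_eq_integral_toReal_smul]
  · refine integral_congr_ae (ae_of_all _ fun p => ?_)
    simp only [Kernel.comap_apply, smul_eq_mul, biOp]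
    rw [ENNReal.toReal_ofReal (mul_nonneg (F.pot_nonneg _ _) (F.pot_nonneg _ _))]
  · exact ((((F.measurable_pot t).comp measurable_fst).mul
      ((F.measurable_pot t).comp measurable_snd)).comp
        (measurable_pi_apply (Fin.last t))).ennreal_ofReal
  · exact ae_of_all _ fun _ => ENNReal.ofReal_lt_top

/-! ## The law of the particle system -/

/-- The particles and their backward indices produced by one step of the algorithm. -/
def newParticles (p : ((Fin N → Fin N) × (Fin N → X)) × (Fin N → Fin M → Fin N)) (k : Fin N) :
    X × (Fin M → Fin N) := (p.1.2 k, p.2 k)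

theorem measurable_newParticles : Measurable (newParticles (X := X) (N := N) (M := M)) := by
  unfold newParticles
  exact measurable_pi_lambda _ fun k =>
    ((measurable_pi_apply k).comp (measurable_snd.comp measurable_fst)).prodMk
      ((measurable_pi_apply k).comp measurable_snd)

theorem stat_zero (b : Fin 1 → Fin 2) (ω : History X N M 0) (k l : Fin N) :
    F.stat 0 b ω k l = sel (b 0) k l := rfl

theorem stat_succ (t : ℕ) (b : Fin (t + 2) → Fin 2) (ω : History X N M (t + 1)) (k l : Fin N) :
    F.stat (t + 1) b ω k l = nextStat (b (Fin.last (t + 1))) (F.weight t (particles t ω.1))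
      (F.stat t (fun s => b s.castSucc) ω.1) ω.2.2 k l := by
  rw [stat, nextStat, sel, pairStat]
  by_cases hc : b (Fin.last (t + 1)) = 0
  · simp only [if_pos hc]
    ring
  · simp only [if_neg hc]
    rw [div_mul_eq_mul_div, mul_div_assoc]
    rfl

theorem sum_weight_le_one (t : ℕ) (x : Fin N → X) : ∑ m, F.weight t x m ≤ 1 := by
  simp only [weight]
  rw [← Finset.sum_div]
  exact div_self_le_one _

theorem stat_nonneg (t : ℕ) (b : Fin (t + 1) → Fin 2) (ω : History X N M t) (k l : Fin N) :
    0 ≤ F.stat t b ω k l := by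
  induction t generalizing k l with
  | zero => exact sel_nonneg _ _ _
  | succ t ih =>
    rw [stat_succ]
    exact nextStat_nonneg (F.weight_nonneg t _) (fun k l => ih _ _ k l) _ _ _

theorem stat_comm (t : ℕ) (b : Fin (t + 1) → Fin 2) (ω : History X N M t) (k l : Fin N) :
    F.stat t b ω k l = F.stat t b ω l k := by
  induction t generalizing k l with
  | zero => exact sel_comm _ _ _
  | succ t ih =>
    rw [stat_succ, stat_succ]
    exact nextStat_comm (fun k l => ih _ _ k l) _ _ _

theorem bddMeas_weight (t : ℕ) (m : Fin N) : BddMeas fun x : Fin N → X => F.weight t x m := by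
  refine ⟨?_, 1, fun x => ?_⟩
  · exact ((F.measurable_pot t).comp (measurable_pi_apply m)).div
      (Finset.measurable_sum _ fun l _ => (F.measurable_pot t).comp (measurable_pi_apply l))
  · rw [abs_of_nonneg (F.weight_nonneg t x m)]
    exact (Finset.single_le_sum (fun i _ => F.weight_nonneg t x i) (Finset.mem_univ m)).trans
      (F.sum_weight_le_one t x)

theorem measurable_history_fst (t : ℕ) :
    Measurable fun ω : History X N M (t + 1) => (ω.1 : History X N M t) := measurable_fst

theorem measurable_history_snd (t : ℕ) : Measurable fun ω : History X N M (t + 1) =>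
    (ω.2 : ((Fin N → Fin N) × (Fin N → X)) × (Fin N → Fin M → Fin N)) := measurable_snd

theorem bddMeas_stat (t : ℕ) (b : Fin (t + 1) → Fin 2) (k l : Fin N) :
    BddMeas fun ω : History X N M t => F.stat t b ω k l := by
  induction t generalizing k l with
  | zero => exact BddMeas.const (sel (b 0) k l)
  | succ t ih =>
    simp only [stat_succ]
    exact BddMeas.nextStat _ (fun j => (F.bddMeas_weight t j).comp
      ((measurable_particles t).comp (measurable_history_fst t)))
      (fun k l => (ih _ k l).comp (measurable_history_fst t))
      (measurable_snd.comp (measurable_history_snd t)) k l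

section Measurability

variable {G : ℝ} (hG : ∀ t x, F.pot t x ≤ G)

include hG in
theorem bddMeas_totalWeight (t : ℕ) :
    BddMeas fun ω : History X N M t => F.totalWeight t ω :=
  BddMeas.sum _ fun i _ => (F.bddMeas_pot hG t).comp
    ((measurable_pi_apply i).comp (measurable_particles t))

include hG in
theorem bddMeas_gammaOne (t : ℕ) : BddMeas fun ω : History X N M t => F.gammaOne t ω := by
  induction t with
  | zero => exact BddMeas.const 1
  | succ t ih =>
    simp only [gammaOne, div_eq_mul_inv]
    exact (ih.comp (measurable_history_fst t)).mul
      (((F.bddMeas_totalWeight hG t).comp (measurable_history_fst t)).mul (BddMeas.const _))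

include hG in
theorem bddMeas_parisEstimator (t : ℕ) (b : Fin (t + 1) → Fin 2) {h : X × X → ℝ}
    (hh : BddMeas h) : BddMeas fun ω : History X N M t => F.parisEstimator t b h ω := by
  unfold parisEstimator
  simp only [div_eq_mul_inv _ ((N : ℝ) ^ 2)]
  refine ((BddMeas.const _).mul (((F.bddMeas_gammaOne hG t).pow 2).mul (BddMeas.const _))).mul
    (BddMeas.sum _ fun i _ => BddMeas.sum _ fun j _ => (F.bddMeas_stat t b i j).mul (hh.comp ?_))
  exact ((measurable_pi_apply i).comp (measurable_particles t)).prodMk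
    ((measurable_pi_apply j).comp (measurable_particles t))

end Measurability

section Law

variable (hpot : ∀ (t : ℕ) (x : X), 0 < F.pot t x)
  (hN : 0 < N) (t : ℕ) {g : History X N M t × (Fin N → X × (Fin M → Fin N)) → ℝ} (hg : BddMeas g)

include hpot hN hg

theorem integral_particleLaw_eq_step (ω : History X N M t) :
    ∫ z, g (ω, z) ∂(Measure.pi fun _ : Fin N => F.particleLaw M t (particles t ω)) =
      ∫ p, g (ω, newParticles p) ∂(F.step N M t (particles t ω)) := by
  rw [← F.step_map hpot hN t]
  exact integral_map (f := fun z => g (ω, z)) measurable_newParticles.aemeasurable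
    (hg.comp measurable_prodMk_left).meas.aestronglyMeasurable

/-- The product law is not itself presented as a kernel in `ω`, so measurability is obtained from
its expression through `step`. -/
theorem bddMeas_integral_particleLaw : BddMeas fun ω : History X N M t =>
    ∫ z, g (ω, z) ∂(Measure.pi fun _ : Fin N => F.particleLaw M t (particles t ω)) := by
  simp only [F.integral_particleLaw_eq_step hpot hN t hg]
  exact BddMeas.integral_kernel (hg.comp (g := fun q : History X N M t ×
    (((Fin N → Fin N) × (Fin N → X)) × (Fin N → Fin M → Fin N)) => (q.1, newParticles q.2))
    (measurable_fst.prodMk (measurable_newParticles.comp measurable_snd)))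
    ((F.step N M t).comap (particles t) (measurable_particles t))

/-- Conditioning on the past for integrands that do not look at the new ancestor indices, as is the
case for the estimator and its statistics. -/
theorem integral_law_succ :
    ∫ ω, g (ω.1, newParticles ω.2) ∂(F.law N M (t + 1)) =
      ∫ ω, ∫ z, g (ω, z) ∂(Measure.pi fun _ : Fin N => F.particleLaw M t (particles t ω))
        ∂(F.law N M t) := by
  simp only [F.integral_particleLaw_eq_step hpot hN t hg]
  exact Measure.integral_compProd ((hg.comp (g := fun q : History X N M t ×
    (((Fin N → Fin N) × (Fin N → X)) × (Fin N → Fin M → Fin N)) => (q.1, newParticles q.2))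
    (measurable_fst.prodMk (measurable_newParticles.comp measurable_snd))).integrable
    (F.law N M t ⊗ₘ (F.step N M t).comap (particles t) (measurable_particles t)))

end Law

/-! ## Convergence of the estimator -/

/-- The normalizing factor of the estimator. -/
def bitProd (N : ℕ) {t : ℕ} (b : Fin (t + 1) → Fin 2) : ℝ := ∏ s, bitFactor N (b s)

theorem bitProd_zero (b : Fin 1 → Fin 2) : bitProd N b = bitFactor N (b 0) := by
  simp [bitProd]

theorem bitProd_succ {t : ℕ} (b : Fin (t + 2) → Fin 2) :
    bitProd N b = bitProd N (fun s => b s.castSucc) * bitFactor N (b (Fin.last (t + 1))) := by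
  rw [bitProd, Fin.prod_univ_castSucc]
  rfl

theorem parisEstimator_eq (t : ℕ) (b : Fin (t + 1) → Fin 2) (h : X × X → ℝ)
    (ω : History X N M t) : F.parisEstimator t b h ω =
      bitProd N b * (F.gammaOne t ω ^ 2 / (N : ℝ) ^ 2) *
        ∑ i, ∑ j, F.stat t b ω i j * h (particles t ω i, particles t ω j) := rfl

/-- The factor in front of the sum over pairs of new particles in the estimator. -/
def stepFactor (t : ℕ) (b : Fin (t + 2) → Fin 2) (ω : History X N M t) : ℝ :=
  bitProd N b * ((F.gammaOne t ω * (F.totalWeight t ω / N)) ^ 2 / (N : ℝ) ^ 2)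

theorem parisEstimator_succ (t : ℕ) (b : Fin (t + 2) → Fin 2) (h : X × X → ℝ)
    (ω : History X N M (t + 1)) :
    F.parisEstimator (t + 1) b h ω = F.stepFactor t b ω.1 * ∑ p : Fin N × Fin N,
      F.pairTerm t (particles t ω.1) (F.stat t (fun s => b s.castSucc) ω.1)
        (b (Fin.last (t + 1))) h p.1 p.2 (newParticles ω.2 p.1, newParticles ω.2 p.2) := by
  rw [parisEstimator_eq, Fintype.sum_prod_type]
  simp only [stat_succ]
  rfl

/-- The two normalized weights contribute `Ω ^ (-2)`, cancelling the `Ω ^ 2` newly gained by `γ ^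
2`, while `bitFactor` times the number of selected pairs is `N ^ 2`. What is left is the
normalization at time `t`, with the potentials absorbed in `biOp`. -/
theorem stepFactor_mul_mean (hpot : ∀ (t : ℕ) (x : X), 0 < F.pot t x) (hN2 : 2 ≤ N) (t : ℕ)
    (b : Fin (t + 2) → Fin 2) (h : X × X → ℝ) (ω : History X N M t) :
    F.stepFactor t b ω * ((∑ k : Fin N, ∑ l : Fin N, sel (b (Fin.last (t + 1))) k l) *
      ∑ m, ∑ n, F.weight t (particles t ω) m * F.weight t (particles t ω) n *
        F.stat t (fun s => b s.castSucc) ω m n *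
          ∫ p, h p ∂(F.biTrans t (b (Fin.last (t + 1))) (particles t ω m, particles t ω n))) =
      F.parisEstimator t (fun s => b s.castSucc) (F.biOp t (b (Fin.last (t + 1))) h) ω := by
  have : Nonempty (Fin N) := ⟨⟨0, by omega⟩⟩
  have hN' : (N : ℝ) ≠ 0 := by
    have : N ≠ 0 := by omega
    exact_mod_cast this
  have hs := sum_sel_mul_bitFactor hN2 (b (Fin.last (t + 1)))
  have hΩ : F.totalWeight t ω ≠ 0 :=
    (Finset.sum_pos (fun i _ => hpot t (particles t ω i)) Finset.univ_nonempty).ne'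
  rw [parisEstimator_eq, stepFactor, bitProd_succ]
  have h1 : ∑ m, ∑ n, F.weight t (particles t ω) m * F.weight t (particles t ω) n *
        F.stat t (fun s => b s.castSucc) ω m n *
          ∫ p, h p ∂(F.biTrans t (b (Fin.last (t + 1))) (particles t ω m, particles t ω n)) =
      (F.totalWeight t ω ^ 2)⁻¹ * ∑ i, ∑ j, F.stat t (fun s => b s.castSucc) ω i j *
        F.biOp t (b (Fin.last (t + 1))) h (particles t ω i, particles t ω j) := by
    simp only [Finset.mul_sum]
    refine Finset.sum_congr rfl fun i _ => Finset.sum_congr rfl fun j _ => ?_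
    have hw : ∀ m, F.weight t (particles t ω) m =
      F.pot t (particles t ω m) / F.totalWeight t ω := fun _ => rfl
    simp only [hw, biOp]
    field_simp
  rw [h1]
  set A := ∑ i, ∑ j, F.stat t (fun s => b s.castSucc) ω i j *
        F.biOp t (b (Fin.last (t + 1))) h (particles t ω i, particles t ω j)
  set S := ∑ k : Fin N, ∑ l : Fin N, sel (b (Fin.last (t + 1))) k l
  set P := bitProd N fun s => b s.castSucc
  calc _ = P * (F.gammaOne t ω ^ 2 / N ^ 2) * A * ((bitFactor N (b (Fin.last (t + 1))) * S) / N ^ 2) := by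
        field_simp
    _ = _ := by
        rw [hs]; field_simp

theorem bddMeas_nextStat_history (t : ℕ) (b : Fin (t + 2) → Fin 2) (k l : Fin N) :
    BddMeas fun q : History X N M t × (Fin N → X × (Fin M → Fin N)) =>
      nextStat (b (Fin.last (t + 1))) (F.weight t (particles t q.1))
        (F.stat t (fun s => b s.castSucc) q.1) (fun k => (q.2 k).2) k l :=
  BddMeas.nextStat _ (fun j => (F.bddMeas_weight t j).comp
    ((measurable_particles t).comp measurable_fst))
    (fun k l => (F.bddMeas_stat t _ k l).comp measurable_fst) (by fun_prop) k l

/-! ### Moment bounds and the mean squared error recursion -/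

section Bounds

variable (hdens : ∀ (t : ℕ) (x x' : X), 0 < F.dens t x' x) (hpot : ∀ (t : ℕ) (x : X), 0 < F.pot t x)
  {G : ℝ} (hG : ∀ t x, F.pot t x ≤ G) (hN2 : 2 ≤ N) (hM : 0 < M)

/-- For the bit `0` there are `N` row sums of size at most `N` and a factor at most `2`. For the bit
`1` the row sums equal `1` and the factor is `N`. Both give order `N ^ 3`, the base of the moment
induction. -/
theorem bitFactor_sq_mul_rowSq_sel_le (hN2 : 2 ≤ N) (c : Fin 2) :
    bitFactor N c ^ 2 * rowSq (sel c : Fin N → Fin N → ℝ) ≤ 4 * (N : ℝ) ^ 3 := by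
  by_cases hc : c = 0
  · subst hc
    have h1 : ∀ k : Fin N, ∑ l : Fin N, sel 0 k l ≤ N := fun k =>
      (Finset.sum_le_sum fun l _ => sel_le_one 0 k l).trans (by simp)
    have h2 : rowSq (sel 0 : Fin N → Fin N → ℝ) ≤ (N : ℝ) ^ 3 :=
      (Finset.sum_le_sum fun k _ => pow_le_pow_left₀
        (Finset.sum_nonneg fun l _ => sel_nonneg 0 k l) (h1 k) 2).trans_eq (by simp; ring)
    have h3 : bitFactor N 0 ^ 2 ≤ 2 ^ 2 :=
      pow_le_pow_left₀ (bitFactor_nonneg hN2 _) (bitFactor_zero_le hN2) 2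
    exact (mul_le_mul h3 h2 (rowSq_nonneg _) (by positivity)).trans_eq (by ring)
  · have hc1 : c = 1 := by omega
    subst hc1
    have h2 : rowSq (sel 1 : Fin N → Fin N → ℝ) = N := by simp [rowSq, sel]
    rw [bitFactor_one, h2]
    have : (0 : ℝ) ≤ (N : ℝ) ^ 3 := by positivity
    nlinarith

include hG in
theorem bddMeas_stepFactor (t : ℕ) (b : Fin (t + 2) → Fin 2) :
    BddMeas fun ω : History X N M t => F.stepFactor t b ω := by
  unfold stepFactor
  simp only [div_eq_mul_inv]
  exact (BddMeas.const _).mul ((((F.bddMeas_gammaOne hG t).mul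
    ((F.bddMeas_totalWeight hG t).mul (BddMeas.const _))).pow 2).mul (BddMeas.const _))

include hG in
theorem bddMeas_gammaOne_mul_rowSq (t : ℕ) (b : Fin (t + 1) → Fin 2) :
    BddMeas fun ω : History X N M t => F.gammaOne t ω ^ 4 * rowSq (F.stat t b ω) :=
  ((F.bddMeas_gammaOne hG t).pow 4).mul
    (BddMeas.sum _ fun k _ => (BddMeas.sum _ fun l _ => F.bddMeas_stat t b k l).pow 2)

include hG in
theorem bddMeas_next_gammaOne_mul_rowSq (t : ℕ) (b : Fin (t + 2) → Fin 2) :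
    BddMeas fun q : History X N M t × (Fin N → X × (Fin M → Fin N)) =>
      (F.gammaOne t q.1 * (F.totalWeight t q.1 / N)) ^ 4 *
        rowSq (nextStat (b (Fin.last (t + 1))) (F.weight t (particles t q.1))
          (F.stat t (fun s => b s.castSucc) q.1) fun k => (q.2 k).2) := by
  simp only [div_eq_mul_inv]
  exact ((((F.bddMeas_gammaOne hG t).mul
    ((F.bddMeas_totalWeight hG t).mul (BddMeas.const _))).comp measurable_fst).pow 4).mul
    (BddMeas.sum _ fun k _ => (BddMeas.sum _ fun l _ =>
      F.bddMeas_nextStat_history t b k l).pow 2)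

theorem gammaOne_mul_rowSq_succ (t : ℕ) (b : Fin (t + 2) → Fin 2) (ω : History X N M (t + 1)) :
    F.gammaOne (t + 1) ω ^ 4 * rowSq (F.stat (t + 1) b ω) =
      (F.gammaOne t ω.1 * (F.totalWeight t ω.1 / N)) ^ 4 *
        rowSq (nextStat (b (Fin.last (t + 1))) (F.weight t (particles t ω.1))
          (F.stat t (fun s => b s.castSucc) ω.1) fun k => (newParticles ω.2 k).2) := by
  congr 1
  unfold rowSq
  simp only [stat_succ]
  rfl

include hdens hpot hG hN2 hM

/-- The second moments of the row sums of the backward statistics. -/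
theorem bitProd_sq_mul_integral_rowSq_le (t : ℕ) (b : Fin (t + 1) → Fin 2) :
    bitProd N b ^ 2 * ∫ ω, F.gammaOne t ω ^ 4 * rowSq (F.stat t b ω) ∂(F.law N M t) ≤
      4 * (8 * G ^ 4) ^ t * (N : ℝ) ^ 3 := by
  have hN : 0 < N := by omega
  induction t with
  | zero =>
    have h1 : ∀ ω : History X N M 0, F.gammaOne 0 ω ^ 4 * rowSq (F.stat 0 b ω) =
        rowSq (sel (b 0) : Fin N → Fin N → ℝ) := by
      intro ω
      simp only [gammaOne, one_pow, one_mul]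
      rfl
    have h2 : IsProbabilityMeasure (F.law N M 0) :=
      inferInstanceAs (IsProbabilityMeasure (Measure.pi fun _ : Fin N => F.init))
    simp only [h1, integral_const, probReal_univ, smul_eq_mul, one_mul, bitProd_zero]
    simpa using bitFactor_sq_mul_rowSq_sel_le hN2 (b 0)
  | succ t ih =>
    have hg := F.bddMeas_next_gammaOne_mul_rowSq (N := N) (M := M) hG t b
    simp only [gammaOne_mul_rowSq_succ]
    have heq := F.integral_law_succ hpot hN t hg
    simp only at heq
    rw [heq, bitProd_succ]
    set c := b (Fin.last (t + 1))
    set b' : Fin (t + 1) → Fin 2 := fun s => b s.castSucc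
    calc _ = bitProd N b' ^ 2 * ∫ ω, bitFactor N c ^ 2 *
          ∫ z, (F.gammaOne t ω * (F.totalWeight t ω / N)) ^ 4 *
            rowSq (nextStat c (F.weight t (particles t ω)) (F.stat t b' ω) fun k => (z k).2)
          ∂(Measure.pi fun _ : Fin N => F.particleLaw M t (particles t ω)) ∂(F.law N M t) := by
          rw [integral_const_mul]; ring
      _ ≤ bitProd N b' ^ 2 * ∫ ω, 8 * G ^ 4 * (F.gammaOne t ω ^ 4 * rowSq (F.stat t b' ω))
            ∂(F.law N M t) := by
          refine mul_le_mul_of_nonneg_left (integral_mono ?_ ?_ fun ω => ?_) (sq_nonneg _)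
          · exact ((BddMeas.const _).mul
              (F.bddMeas_integral_particleLaw hpot hN t hg)).integrable _
          · exact ((BddMeas.const _).mul (F.bddMeas_gammaOne_mul_rowSq hG t b')).integrable _
          · have := F.bitFactor_sq_mul_integral_rowSq_le hdens hpot hN hM t (particles t ω)
              (F.stat t b' ω) hN2 (hG t) (F.stat_nonneg t b' ω) c
            -- The past value of `γ ^ 4` is constant under the conditional expectation and
            -- multiplies the one-step bound.
            have h0 : 0 ≤ F.gammaOne t ω ^ 4 := by positivity
            have h2 := mul_le_mul_of_nonneg_left this h0
            dsimp only
            rw [integral_const_mul]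
            refine le_trans (le_of_eq ?_) (h2.trans_eq (by ring))
            rw [mul_pow]
            unfold totalWeight
            ring
      _ = 8 * G ^ 4 * (bitProd N b' ^ 2 * ∫ ω, F.gammaOne t ω ^ 4 * rowSq (F.stat t b' ω)
            ∂(F.law N M t)) := by
          rw [integral_const_mul]; ring
      _ ≤ 8 * G ^ 4 * (4 * (8 * G ^ 4) ^ t * (N : ℝ) ^ 3) :=
          mul_le_mul_of_nonneg_left (ih b') (by positivity)
      _ = _ := by ring

/-- The mean squared error at time `t + 1` in terms of the error at time `t`. -/
theorem integral_sq_error_succ_le (t : ℕ) (b : Fin (t + 2) → Fin 2) {h : X × X → ℝ}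
    (hh : BddMeas h) {H : ℝ} (hH : ∀ p, |h p| ≤ H) (m : ℝ) :
    ∫ ω, (F.parisEstimator (t + 1) b h ω - m) ^ 2 ∂(F.law N M (t + 1)) ≤
      16 * H ^ 2 * (8 * G ^ 4) ^ (t + 1) / N +
      ∫ ω, (F.parisEstimator t (fun s => b s.castSucc)
        (F.biOp t (b (Fin.last (t + 1))) h) ω - m) ^ 2 ∂(F.law N M t) := by
  have hN : 0 < N := by omega
  have hN' : (0 : ℝ) < N := by exact_mod_cast hN
  have hmom := F.bitProd_sq_mul_integral_rowSq_le hdens hpot hG hN2 hM (t + 1) b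
  simp only [gammaOne_mul_rowSq_succ] at hmom
  have hgr := F.bddMeas_next_gammaOne_mul_rowSq (N := N) (M := M) hG t b
  have heqr := F.integral_law_succ hpot hN t hgr
  simp only at heqr
  rw [heqr] at hmom
  simp only [parisEstimator_succ]
  set c := b (Fin.last (t + 1)) with hc
  set b' : Fin (t + 1) → Fin 2 := fun s => b s.castSucc with hb'
  have hge : BddMeas fun q : History X N M t × (Fin N → X × (Fin M → Fin N)) =>
      (F.stepFactor t b q.1 * ∑ p : Fin N × Fin N, F.pairTerm t (particles t q.1)
        (F.stat t b' q.1) c h p.1 p.2 (q.2 p.1, q.2 p.2) - m) ^ 2 := by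
    refine ((((F.bddMeas_stepFactor hG t b).comp measurable_fst).mul
      (BddMeas.sum _ fun p _ => ?_)).sub (BddMeas.const m)).pow 2
    exact (F.bddMeas_nextStat_history t b p.1 p.2).mul (hh.comp (by fun_prop))
  have heqe := F.integral_law_succ hpot hN t hge
  simp only at heqe
  rw [heqe]
  have hI := F.bddMeas_integral_particleLaw hpot hN t hgr
  have hE : BddMeas fun ω : History X N M t =>
      (F.parisEstimator t b' (F.biOp t c h) ω - m) ^ 2 :=
    ((F.bddMeas_parisEstimator hG t b' (F.bddMeas_biOp hG t c hh)).sub (BddMeas.const m)).pow 2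
  -- Conditional bias–variance decomposition: the variance is controlled by the row sums, and the
  -- squared bias is the squared error at time `t` relative to the same `m`. Leaving `m` arbitrary
  -- lets it be the target value, unchanged from time `t + 1` to time `t`.
  have hpt : ∀ ω : History X N M t,
      ∫ z, (F.stepFactor t b ω * ∑ p : Fin N × Fin N, F.pairTerm t (particles t ω)
        (F.stat t b' ω) c h p.1 p.2 (z p.1, z p.2) - m) ^ 2
        ∂(Measure.pi fun _ : Fin N => F.particleLaw M t (particles t ω)) ≤
      4 * H ^ 2 * (bitProd N b ^ 2 / (N : ℝ) ^ 4) *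
        ∫ z, (F.gammaOne t ω * (F.totalWeight t ω / N)) ^ 4 *
          rowSq (nextStat c (F.weight t (particles t ω)) (F.stat t b' ω) fun k => (z k).2)
          ∂(Measure.pi fun _ : Fin N => F.particleLaw M t (particles t ω)) +
      (F.parisEstimator t b' (F.biOp t c h) ω - m) ^ 2 := by
    intro ω
    have := F.isProbabilityMeasure_particleLaw (M := M) hdens hpot hN t (particles t ω)
    have hterm : ∀ k l, BddMeas fun z : Fin N → X × (Fin M → Fin N) =>
        F.pairTerm t (particles t ω) (F.stat t b' ω) c h k l (z k, z l) := fun k l =>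
      (F.bddMeas_pairTerm t (particles t ω) (F.stat t b' ω) c hh k l).comp (by fun_prop)
    rw [integral_sq_mul_sub _ (BddMeas.sum _ fun p _ => hterm p.1 p.2)]
    refine add_le_add ?_ (le_of_eq ?_)
    · have hv := F.variance_sum_pairTerm_le hdens hpot hN hM t (particles t ω) (F.stat t b' ω)
        (F.stat_nonneg t b' ω) (F.stat_comm t b' ω) c hh hH
      rw [integral_const_mul]
      refine (mul_le_mul_of_nonneg_left hv (sq_nonneg _)).trans_eq ?_
      rw [stepFactor]
      ring
    · rw [← F.stepFactor_mul_mean hpot hN2 t b h ω, integral_finsetSum _ fun p _ =>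
        (hterm p.1 p.2).integrable _]
      have hmean := fun k l => F.integral_nextStat hdens hpot hN hM t (particles t ω)
        (F.stat t b' ω) c k l hh
      rw [Fintype.sum_prod_type, Finset.sum_mul]
      congr 3
      refine Finset.sum_congr rfl fun k _ => ?_
      rw [Finset.sum_mul]
      exact Finset.sum_congr rfl fun l _ => hmean k l
  refine (integral_mono ((F.bddMeas_integral_particleLaw hpot hN t hge).integrable _)
    ((((BddMeas.const _).mul hI).add hE).integrable _) hpt).trans ?_
  rw [integral_add (((BddMeas.const _).mul hI).integrable _) (hE.integrable _),
    integral_const_mul]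
  refine add_le_add ?_ le_rfl
  -- `N ^ (-4)` comes from squaring the prefactor `1 / N ^ 2`, against `N ^ 3` from the moments of
  -- the row sums.
  calc _ = 4 * H ^ 2 / (N : ℝ) ^ 4 * (bitProd N b ^ 2 * _) := by ring
    _ ≤ 4 * H ^ 2 / (N : ℝ) ^ 4 * (4 * (8 * G ^ 4) ^ (t + 1) * (N : ℝ) ^ 3) :=
        mul_le_mul_of_nonneg_left hmom (by positivity)
    _ = _ := by field_simp; ring

end Bounds

/-- At time `0` the estimator is unbiased, since `bitFactor` normalizes the number of selected
pairs, so the error is a pure variance covered by `variance_pair_sum_le`. -/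
theorem integral_sq_error_zero_le (hN2 : 2 ≤ N) (b : Fin 1 → Fin 2) {h : X × X → ℝ}
    (hh : BddMeas h) {H : ℝ} (hH : ∀ p, |h p| ≤ H) :
    ∫ ω, (F.parisEstimator 0 b h ω - F.muTerminal 0 b h) ^ 2 ∂(F.law N M 0) ≤
      16 * H ^ 2 / N := by
  have hN' : (0 : ℝ) < N := by
    have : 0 < N := by omega
    exact_mod_cast this
  set c := b 0 with hc
  set P := Measure.pi fun _ : Fin N => F.init with hP
  let f : Fin N → Fin N → X × X → ℝ := fun k l p => sel c k l * h p
  have hf : ∀ k l, BddMeas (f k l) := fun k l => (BddMeas.const _).mul hh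
  have hterm : ∀ k l, BddMeas fun z : Fin N → X => f k l (z k, z l) := fun k l =>
    (hf k l).comp (by fun_prop)
  have hmean : ∀ k l, ∫ z, f k l (z k, z l) ∂P = sel c k l * ∫ p, h p ∂(F.biInit c) := by
    intro k l
    simp only [f]
    rw [integral_const_mul]
    by_cases hs : sel c k l = 0
    · rw [hs, zero_mul, zero_mul]
    congr 1
    rcases (by omega : c = 0 ∨ c = 1) with h0 | h1
    · rw [h0] at hs ⊢
      have hkl : k ≠ l := fun h => hs (by simp [sel, h])
      rw [biInit, if_pos rfl, ← pi_map_pair F.init hkl, integral_map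
        ((measurable_pi_apply k).prodMk (measurable_pi_apply l)).aemeasurable
        hh.meas.aestronglyMeasurable]
    · rw [h1] at hs ⊢
      have hkl : k = l := by
        by_contra h
        exact hs (by simp [sel, h])
      subst hkl
      rw [biInit, if_neg (by decide), integral_map (by fun_prop) hh.meas.aestronglyMeasurable]
      have h2 := (measurePreserving_eval (fun _ : Fin N => F.init) k).map_eq
      have h3 : Measurable fun x : X => h (x, x) := hh.meas.comp (by fun_prop)
      rw [← h2, integral_map (measurable_pi_apply k).aemeasurable h3.aestronglyMeasurable]
  have hest : ∀ ω : History X N M 0, F.parisEstimator 0 b h ω =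
      bitFactor N c / (N : ℝ) ^ 2 *
        ∑ p : Fin N × Fin N, f p.1 p.2 (particles 0 ω p.1, particles 0 ω p.2) := by
    intro ω
    rw [parisEstimator_eq, bitProd_zero, Fintype.sum_prod_type]
    simp only [gammaOne, stat_zero, one_pow, mul_one_div, f]
    rfl
  rw [F.muTerminal_zero b hh]
  simp only [hest]
  change ∫ z : Fin N → X, (bitFactor N c / (N : ℝ) ^ 2 *
    ∑ p : Fin N × Fin N, f p.1 p.2 (z p.1, z p.2) - ∫ p, h p ∂(F.biInit c)) ^ 2 ∂P ≤ _
  refine (integral_sq_mul_sub P (BddMeas.sum _ fun p _ => hterm p.1 p.2) _ _).trans_le ?_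
  have hv := variance_pair_sum_le F.init f hf (sel_nonneg c) hmean
  have hrow : ∫ z, ∑ j, (∑ l, |f j l (z j, z l)| + ∑ l, |f l j (z l, z j)|) ^ 2 ∂P ≤
      4 * H ^ 2 * rowSq (sel c : Fin N → Fin N → ℝ) := by
    have hint : BddMeas fun z : Fin N → X =>
        ∑ j, (∑ l, |f j l (z j, z l)| + ∑ l, |f l j (z l, z j)|) ^ 2 :=
      BddMeas.sum _ fun j _ => ((BddMeas.sum _ fun l _ => (hterm j l).abs).add
        (BddMeas.sum _ fun l _ => (hterm l j).abs)).pow 2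
    refine (integral_mono (hint.integrable P) (integrable_const _) fun z => ?_).trans_eq
      (by simp : ∫ _, 4 * H ^ 2 * rowSq (sel c : Fin N → Fin N → ℝ) ∂P = _)
    simp only [rowSq, Finset.mul_sum]
    refine Finset.sum_le_sum fun j _ => ?_
    have hle : ∀ k l, |f k l (z k, z l)| ≤ H * sel c k l := fun k l => by
      simp only [f]
      rw [abs_mul, abs_of_nonneg (sel_nonneg c k l), mul_comm]
      exact mul_le_mul_of_nonneg_right (hH _) (sel_nonneg c k l)
    have ha : ∑ l, |f j l (z j, z l)| ≤ H * ∑ l, sel c j l := by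
      rw [Finset.mul_sum]; exact Finset.sum_le_sum fun l _ => hle j l
    have hb : ∑ l, |f l j (z l, z j)| ≤ H * ∑ l, sel c j l := by
      rw [Finset.mul_sum]
      exact Finset.sum_le_sum fun l _ => (hle l j).trans_eq (by rw [sel_comm])
    have h1 : ∑ l, |f j l (z j, z l)| + ∑ l, |f l j (z l, z j)| ≤ 2 * H * ∑ l, sel c j l := by
      linarith
    exact (pow_le_pow_left₀ (by positivity) h1 2).trans_eq (by ring)
  have hmeantot : bitFactor N c / (N : ℝ) ^ 2 *
      ∫ z, ∑ p : Fin N × Fin N, f p.1 p.2 (z p.1, z p.2) ∂P = ∫ p, h p ∂(F.biInit c) := by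
    rw [integral_finsetSum _ fun p _ => (hterm p.1 p.2).integrable _, Fintype.sum_prod_type]
    simp only [hmean, ← Finset.sum_mul]
    rw [← mul_assoc, div_mul_eq_mul_div, sum_sel_mul_bitFactor hN2 c, div_self (by positivity),
      one_mul]
  rw [hmeantot, sub_self, zero_pow two_ne_zero, add_zero]
  calc _ ≤ (bitFactor N c / (N : ℝ) ^ 2) ^ 2 *
        (4 * H ^ 2 * rowSq (sel c : Fin N → Fin N → ℝ)) :=
        mul_le_mul_of_nonneg_left (hv.trans hrow) (sq_nonneg _)
    _ = 4 * H ^ 2 / (N : ℝ) ^ 4 * (bitFactor N c ^ 2 * rowSq (sel c : Fin N → Fin N → ℝ)) := by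
        ring
    _ ≤ 4 * H ^ 2 / (N : ℝ) ^ 4 * (4 * (N : ℝ) ^ 3) :=
        mul_le_mul_of_nonneg_left (bitFactor_sq_mul_rowSq_sel_le hN2 c) (by positivity)
    _ = _ := by field_simp; ring

/-- The mean squared error of the estimator is of order `1 / N`. -/
theorem exists_integral_sq_error_le (hdens : ∀ (t : ℕ) (x x' : X), 0 < F.dens t x' x)
    (hpot : ∀ (t : ℕ) (x : X), 0 < F.pot t x) {G : ℝ} (hG : ∀ t x, F.pot t x ≤ G) (hM : 0 < M)
    (t : ℕ) (b : Fin (t + 1) → Fin 2) {h : X × X → ℝ} (hh : BddMeas h) :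
    ∃ C : ℝ, ∀ N, 2 ≤ N →
      ∫ ω, (F.parisEstimator t b h ω - F.muTerminal t b h) ^ 2 ∂(F.law N M t) ≤ C / N := by
  induction t generalizing h with
  | zero =>
    obtain ⟨H, hH⟩ := hh.bdd
    exact ⟨16 * H ^ 2, fun N hN2 => F.integral_sq_error_zero_le hN2 b hh hH⟩
  | succ t ih =>
    obtain ⟨H, hH⟩ := hh.bdd
    obtain ⟨C, hC⟩ := ih (fun s => b s.castSucc) (F.bddMeas_biOp hG t (b (Fin.last (t + 1))) hh)
    refine ⟨16 * H ^ 2 * (8 * G ^ 4) ^ (t + 1) + C, fun N hN2 => ?_⟩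
    rw [F.muTerminal_succ hG t b hh, add_div]
    exact (F.integral_sq_error_succ_le hdens hpot hG hN2 hM t b hh hH _).trans
      (add_le_add le_rfl (hC N hN2))

theorem exists_parisL2Error_le (hdens : ∀ (t : ℕ) (x x' : X), 0 < F.dens t x' x)
    (hpot : ∀ (t : ℕ) (x : X), 0 < F.pot t x) {G : ℝ} (hG : ∀ t x, F.pot t x ≤ G) (hM : 0 < M)
    (t : ℕ) (b : Fin (t + 1) → Fin 2) {h : X × X → ℝ} (hh : BddMeas h) :
    ∃ C : ℝ, ∀ N, 2 ≤ N →
      F.parisL2Error t b h M N ≤ ENNReal.ofReal (C / √(N : ℝ)) := by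
  obtain ⟨C, hC⟩ := F.exists_integral_sq_error_le hdens hpot hG hM t b hh
  refine ⟨√C, fun N hN2 => ?_⟩
  have hb := (F.bddMeas_parisEstimator (N := N) (M := M) hG t b hh).sub
    (BddMeas.const (F.muTerminal t b h))
  rw [parisL2Error, (hb.memLp 2 _).eLpNorm_eq_integral_rpow_norm two_ne_zero ENNReal.ofNat_ne_top]
  refine ENNReal.ofReal_le_ofReal ?_
  simp only [ENNReal.toReal_ofNat, Real.rpow_ofNat, Real.norm_eq_abs, sq_abs]
  rw [← Real.sqrt_div' _ (Nat.cast_nonneg N), ← one_div, ← Real.sqrt_eq_rpow]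
  exact Real.sqrt_le_sqrt (hC N hN2)

end Model

end PaRIS

end

/-! ### Conclusion -/

theorem mainTheorem4 {X : Type*} [MeasurableSpace X] (F : PaRIS.Model X)
    (hpot : ∃ G : ℝ, 0 < G ∧ ∀ (t : ℕ) (x : X), 0 < F.pot t x ∧ F.pot t x ≤ G)
    (hpos : ∀ (t : ℕ) (x x' : X), 0 < F.dens t x' x)
    (σp : ℝ) (hσp : 0 < σp) (hup : ∀ (t : ℕ) (x x' : X), F.dens t x' x ≤ σp)
    (t : ℕ) (b : Fin (t + 1) → Fin 2) (M : ℕ) (hM : 1 < M)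
    (h : X × X → ℝ) (hmeas : Measurable h) (hbdd : ∃ C : ℝ, ∀ z, |h z| ≤ C) :
    (∀ N : ℕ, MemLp (fun ω : PaRIS.History X N M t => F.parisEstimator t b h ω) 2 (F.law N M t)) ∧
    Tendsto (fun N : ℕ => F.parisL2Error t b h M N) atTop (𝓝 0) ∧
    ((∃ σm : ℝ, 0 < σm ∧ σm < σp ∧ ∀ (t : ℕ) (x x' : X), σm ≤ F.dens t x' x) →
      ∃ C : ℝ, ∀ᶠ N : ℕ in atTop,
        F.parisL2Error t b h M N ≤ ENNReal.ofReal (C / √(N : ℝ))) := by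
  obtain ⟨G, -, hG⟩ := hpot
  have hh : PaRIS.BddMeas h := ⟨hmeas, hbdd⟩
  have hG2 : ∀ t x, F.pot t x ≤ G := fun t x => (hG t x).2
  obtain ⟨C, hC⟩ := F.exists_parisL2Error_le hpos (fun t x => (hG t x).1) hG2
    (by omega : 0 < M) t b hh
  -- The bound starts at `N = 2`, because the factor `N / (N - 1)` degenerates at `N = 1`.
  have hev : ∀ᶠ N : ℕ in atTop, F.parisL2Error t b h M N ≤ ENNReal.ofReal (C / √(N : ℝ)) :=
    (eventually_ge_atTop 2).mono hC
  refine ⟨fun N => (F.bddMeas_parisEstimator hG2 t b hh).memLp 2 _, ?_, fun _ => ⟨C, hev⟩⟩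
  refine tendsto_of_tendsto_of_tendsto_of_le_of_le' tendsto_const_nhds ?_
    (Eventually.of_forall fun _ => zero_le) hev
  have h1 : Tendsto (fun N : ℕ => C / √(N : ℝ)) atTop (𝓝 0) :=
    tendsto_const_nhds.div_atTop (Real.tendsto_sqrt_atTop.comp tendsto_natCast_atTop_atTop)
  simpa using ENNReal.tendsto_ofReal h1
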